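/- Let $\mathcal F$ be the class of convex functions $f:[0,\infty)\to\mathbb R$, continuous at $0$, with $f(1)=0$, that are twice differentiable on $(0,\infty)$ with $f''>0$ and $1/f''$ concave on $(0,\infty)$. For probability measures $P,Q$ let $D_f(P\|Q)=\mathbb E_Q\big[f\big(\tfrac{dP}{dQ}\big)\big]\in[0,\infty]$ if $P\ll Q$, and $D_f(P\|Q)=\infty$ otherwise. For a pair $(A,B)$ of random variables with joint law $P_{AB}$ put $$I_f^{\mathrm{CKZ}}(A;B)=D_f(P_{AB}\|P_A\times P_B),\qquad I_f^{\mathrm{MBGYA}}(A;B)=\inf_{Q_B}\big\{D_f(P_{AB}\|P_A\times Q_B)-D_f(P_B\|Q_B)\big\},$$ where the infimum is over the probability measures $Q_B$ with $P_B\ll Q_B$ and $D_f(P_B\|Q_B)<\infty$. Let $\mathcal Z,\mathcal W$ be measurable spaces, $\mu$ a probability measure on $\mathcal Z$, and $\ell:\mathcal W\times\mathcal Z\to\mathbb R$ a measurable loss function such that $\ell(w,\cdot)$ is $\mu$-integrable for every $w$. Put $L_\mu(w)=\int\ell(w,z)\,\mu(dz)$, $\mathrm{gen}_\mu(w,z)=L_\mu(w)-\ell(w,z)$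 for $z\in\mathcal Z$, and $\mathrm{gen}_\mu(w,s)=L_\mu(w)-\frac1n\sum_{i=1}^n\ell(w,z_i)$ for $s=(z_1,\dots,z_n)\in\mathcal Z^n$. Let $S=(Z_1,\dots,Z_n)\sim\mu^{\otimes n}$ with $n\ge1$, and let $Z\sim\mu$. An algorithm $\mathsf A$ is a Markov kernel $P_{W|S}$ from $\mathcal Z^n$ to $\mathcal W$ such that $\mathrm{gen}_\mu(W,Z_i)$ is integrable for every $i$; its output is $W=\mathsf A(S)$, and $\mathrm{gen}(\mu,\mathsf A)=\mathbb E[\mathrm{gen}_\mu(W,S)]$. For $I_f\in\{I_f^{\mathrm{CKZ}},I_f^{\mathrm{MBGYA}}\}$ and $R\in[0,\infty]$ let $$\mathcal U_1^{I_f}(R)=\sup_{P_{W|S}:\ I_f(S;W)\le R}\mathbb E[\mathrm{gen}_\mu(W,S)],\qquad \mathcal U_2^{I_f}(R)=\sup_{P_{\hat W|Z}:\ I_f(Z;\hat W)\le R}\mathbb E[\mathrm{gen}_\mu(\hat W,Z)]$$ in $[-\infty,\infty]$, the first supremum being over algorithms and the second over the Markov kernels from $\mathcal Z$ to $\mathcal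 W$ for which $\mathrm{gen}_\mu(\hat W,Z)$ is integrable. **Theorem.** Let $f\in\mathcal F$. For both the CKZ and the MBGYA notion of mutual $f$-information and every $n\ge1$, $$\mathcal U_1^{I_f}(R)\le\mathcal U_2^{I_f}(R/n)\qquad\text{for all }R\in[0,\infty].$$ Consequently, for every algorithm $\mathsf A$, $$\mathrm{gen}(\mu,\mathsf A)\le\mathcal U_2^{I_f}\!\left(\frac{I_f(S;\mathsf A(S))}{n}\right).$$ Furthermore, if $\mathcal Z$ is finite and the singletons of $\mathcal Z$ and of $\mathcal W$ are measurable, then for the CKZ notion and every $R\in[0,\infty]$ the value of $\mathcal U_2^{I_f}(R)$ does not change when the supremum is restricted to the kernels $P_{\hat W|Z}$ for which the law of $\hat W$ is concentrated on a set of at most $|\mathcal Z|+1$ points. -/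

import Mathlib

open MeasureTheory ProbabilityTheory Set
open scoped ENNReal

namespace GenBound

/-- The class `𝓕` of convex functions `f` on `[0, ∞)` with `f 1 = 0` and `f 0 = f (0+)` that are
twice differentiable on `(0, ∞)`, with `f'' > 0` and `1 / f''` concave there. Values of `f` at
negative arguments are irrelevant. -/
structure ClassF (f : ℝ → ℝ) : Prop where
  convexOn : ConvexOn ℝ (Ici 0) f
  continuousWithinAt_zero : ContinuousWithinAt f (Ici 0) 0
  map_one : f 1 = 0
  differentiableOn : DifferentiableOn ℝ f (Ioi 0)
  differentiableOn_deriv : DifferentiableOn ℝ (deriv f) (Ioi 0)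
  deriv_deriv_pos : ∀ t, 0 < t → 0 < deriv (deriv f) t
  concaveOn_inv : ConcaveOn ℝ (Ioi 0) fun t => 1 / deriv (deriv f) t

open Classical in
/-- The `f`-divergence `D_f(P ‖ Q) = 𝔼_Q [f (dP/dQ)]` of probability measures, in `[0, ∞]`.
For convex `f` with `f 1 = 0` the function `f (dP/dQ)` is bounded below by a `Q`-integrable
function and has nonnegative integral, so that a failure of integrability means that the integral
is `+∞`. If `P` is not absolutely continuous with respect to `Q`, the value is `+∞`: this is the
usual convention for functions of superlinear growth, such as the members of `ClassF`. -/
noncomputable def fDiv {X : Type*} [MeasurableSpace X] (f : ℝ → ℝ) (P Q : Measure X) : ℝ≥0∞ :=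
  if P ≪ Q ∧ Integrable (fun x => f (P.rnDeriv Q x).toReal) Q then
    ENNReal.ofReal (∫ x, f (P.rnDeriv Q x).toReal ∂Q)
  else ∞

/-- The two notions of mutual `f`-information. -/
inductive InfoKind
  | CKZ
  | MBGYA

/-- The mutual `f`-information `I_f(A; B)` of a pair `(A, B)` with joint law `P`:
* CKZ: `D_f(P_{AB} ‖ P_A × P_B)`;
* MBGYA: the infimum of `D_f(P_{AB} ‖ P_A × Q_B) - D_f(P_B ‖ Q_B)` over the probability measures
  `Q_B` with `P_B ≪ Q_B`. The difference is formed only where the subtrahend is finite (if it is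
  infinite, so is the minuend, by data processing). It is then nonnegative, again by data
  processing, so that the subtraction in `[0, ∞]` does not truncate. -/
noncomputable def mutualInfo {A B : Type*} [MeasurableSpace A] [MeasurableSpace B]
    (k : InfoKind) (f : ℝ → ℝ) (P : Measure (A × B)) : ℝ≥0∞ :=
  match k with
  | .CKZ => fDiv f P (P.fst.prod P.snd)
  | .MBGYA =>
      ⨅ (Q : Measure B) (_ : IsProbabilityMeasure Q) (_ : P.snd ≪ Q) (_ : fDiv f P.snd Q ≠ ∞),
        fDiv f P (P.fst.prod Q) - fDiv f P.snd Q

section Learning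

variable {Z W : Type*} [MeasurableSpace Z] [MeasurableSpace W]

/-- The population risk `L_μ(w) = 𝔼_μ [ℓ(w, Z)]`. -/
noncomputable def popRisk (ℓ : W → Z → ℝ) (μ : Measure Z) (w : W) : ℝ :=
  ∫ z, ℓ w z ∂μ

/-- The empirical risk `L_s(w) = (1/n) ∑ ℓ(w, z_i)` of `w` on the data set `s = (z_1, …, z_n)`. -/
noncomputable def empRisk {n : ℕ} (ℓ : W → Z → ℝ) (s : Fin n → Z) (w : W) : ℝ :=
  (1 / (n : ℝ)) * ∑ i, ℓ w (s i)

/-- The generalization gap `gen_μ(w, s) = L_μ(w) - L_s(w)` on a data set `s`. -/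
noncomputable def genGap {n : ℕ} (ℓ : W → Z → ℝ) (μ : Measure Z) (w : W) (s : Fin n → Z) : ℝ :=
  popRisk ℓ μ w - empRisk ℓ s w

/-- The generalization gap `gen_μ(w, z) = L_μ(w) - ℓ(w, z)` on a single sample `z`. -/
noncomputable def genGapOne (ℓ : W → Z → ℝ) (μ : Measure Z) (w : W) (z : Z) : ℝ :=
  popRisk ℓ μ w - ℓ w z

/-- The joint law of `(S, W)`, where `S` consists of `n` i.i.d. samples from `μ` and `W` is the
output on the input `S` of the (randomized) algorithm with Markov kernel `κ = P_{W|S}`. -/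
noncomputable def jointLaw {n : ℕ} (μ : Measure Z) (κ : Kernel (Fin n → Z) W) :
    Measure ((Fin n → Z) × W) :=
  (Measure.pi fun _ => μ).compProd κ

/-- The joint law of `(Z, W)`, where `Z` has law `μ` and `W` is generated by `κ = P_{W|Z}`. -/
noncomputable def jointLawOne (μ : Measure Z) (κ : Kernel Z W) : Measure (Z × W) :=
  μ.compProd κ

/-- The generalization error `gen(μ, 𝖠) = 𝔼 [gen_μ(W, S)]` of the algorithm `κ = P_{W|S}`. -/
noncomputable def genError {n : ℕ} (ℓ : W → Z → ℝ) (μ : Measure Z)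
    (κ : Kernel (Fin n → Z) W) : ℝ :=
  ∫ p, genGap ℓ μ p.2 p.1 ∂(jointLaw μ κ)

/-- The expected gap `𝔼 [gen_μ(W, Z)]` on a single sample, for `κ = P_{W|Z}`. -/
noncomputable def genErrorOne (ℓ : W → Z → ℝ) (μ : Measure Z) (κ : Kernel Z W) : ℝ :=
  ∫ p, genGapOne ℓ μ p.2 p.1 ∂(jointLawOne μ κ)

/-- `κ` is a Markov kernel for which the expectations `𝔼 [gen_μ(W, Z_i)]`, whose average is the
generalization error, all exist. -/
structure IsAlgorithm {n : ℕ} (ℓ : W → Z → ℝ) (μ : Measure Z)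
    (κ : Kernel (Fin n → Z) W) : Prop where
  isMarkovKernel : IsMarkovKernel κ
  integrable : ∀ i, Integrable (fun p => genGapOne ℓ μ p.2 (p.1 i)) (jointLaw μ κ)

/-- `κ` is a Markov kernel for which the expectation `𝔼 [gen_μ(W, Z)]` exists. -/
structure IsAlgorithmOne (ℓ : W → Z → ℝ) (μ : Measure Z) (κ : Kernel Z W) : Prop where
  isMarkovKernel : IsMarkovKernel κ
  integrable : Integrable (fun p => genGapOne ℓ μ p.2 p.1) (jointLawOne μ κ)

/-- `𝓤₁(R)`: the supremum of `𝔼 [gen_μ(W, S)]` over the kernels `P_{W|S}` with `I_f(S; W) ≤ R`,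
for `n` i.i.d. samples. -/
noncomputable def U₁ (k : InfoKind) (f : ℝ → ℝ) (ℓ : W → Z → ℝ) (μ : Measure Z) (n : ℕ)
    (R : ℝ≥0∞) : EReal :=
  ⨆ (κ : Kernel (Fin n → Z) W) (_ : IsAlgorithm ℓ μ κ)
    (_ : mutualInfo k f (jointLaw μ κ) ≤ R), (genError ℓ μ κ : EReal)

/-- `𝓤₂(R)`: the supremum of `𝔼 [gen_μ(W, Z)]` over the kernels `P_{W|Z}` with
`I_f(Z; W) ≤ R`. -/
noncomputable def U₂ (k : InfoKind) (f : ℝ → ℝ) (ℓ : W → Z → ℝ) (μ : Measure Z)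
    (R : ℝ≥0∞) : EReal :=
  ⨆ (κ : Kernel Z W) (_ : IsAlgorithmOne ℓ μ κ)
    (_ : mutualInfo k f (jointLawOne μ κ) ≤ R), (genErrorOne ℓ μ κ : EReal)

/-- The supremum that defines `𝓤₂(R)`, restricted to the kernels `P_{W|Z}` for which the law of
the output `W` is concentrated on a set of at most `m` points. -/
noncomputable def U₂Supp (k : InfoKind) (f : ℝ → ℝ) (ℓ : W → Z → ℝ) (μ : Measure Z)
    (R : ℝ≥0∞) (m : ℕ) : EReal :=
  ⨆ (κ : Kernel Z W) (_ : IsAlgorithmOne ℓ μ κ)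
    (_ : mutualInfo k f (jointLawOne μ κ) ≤ R)
    (_ : ∃ T : Finset W, T.card ≤ m ∧ (jointLawOne μ κ).snd (T : Set W)ᶜ = 0),
    (genErrorOne ℓ μ κ : EReal)

end Learning

end GenBound

/-!
The Bregman divergence `f x - f y - f' y * (x - y)` is jointly convex in `(x, y)`, because `1 / f''`
is concave (`ClassF.bregman_convex`). The entropy `∫ f (g) - f (∫ g)` is the integral of the Bregman
divergence of `g` and its mean, and so it inherits convexity in `g`. Integration of the supporting
hyperplane `ClassF.bregman_support` over a product space gives the superadditivity of the entropy
(`entropy_superadditive_prod`), and induction extends it to `n` i.i.d. samples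
(`entropy_superadditive_pi`): the entropies of the conditional means of `g` given the single samples
`Z_i` add up to at most the entropy of `g`.

Apply this, for each output `w`, to the density `g = G (·, w)` of the joint law of `(S, W)` with
respect to `μⁿ × Q`, and integrate over `Q`. The marginals of `G` are the densities of the joint
laws of `(Z_i, W)` with respect to `μ × Q`. The average over `i` of the kernels `P_{W|Z_i}` is
again a kernel from the sample space (`averagedKernel`); it has the same output law as the
algorithm and, by Jensen's inequality, at most the average divergence. Therefore the excess of
its divergence over `D_f (P_W ‖ Q)` is at most `1 / n` times that of the algorithm
(`natCast_mul_fDiv_averagedKernel_le`). The case `Q = P_W` is the bound for CKZ, and the infimum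
over `Q` the one for MBGYA (`mutualInfo_averagedKernel_le`). The averaged kernel has the same
generalization error as the algorithm, so the algorithm with information `R` is matched by a
single-sample kernel with information at most `R / n`. To avoid `∞ - ∞`, `f` is replaced by
`normalized f`, which is nonnegative and has the same divergence.

For a finite sample space, the conditional law of `Z` given `W = w`, its divergence from `μ` and
the conditional mean of the gap are functions of `w`, and the constraints and the objective are
their means under the output law. The mean of a vector in a finite-dimensional space is a convex
combination of finitely many of its values (`integral_mem_convexHull`). A basic solution of the
linear program that maximizes the gap under the `|Z|` constraints of the conditional law and the
one of the divergence has at most `|Z| + 1` atoms (`exists_basic_solution`), and the kernel with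
this output law and the same conditional laws of `Z` is at least as good
(`exists_discreteKernel`).
-/

namespace GenBound

/-! ### Joint convexity of the Bregman divergence -/

namespace ClassF

variable {f : ℝ → ℝ}

lemma hasDerivAt (hf : ClassF f) {t : ℝ} (ht : 0 < t) : HasDerivAt f (deriv f t) t :=
  ((hf.differentiableOn t ht).differentiableAt (Ioi_mem_nhds ht)).hasDerivAt

lemma hasDerivAt_deriv (hf : ClassF f) {t : ℝ} (ht : 0 < t) :
    HasDerivAt (deriv f) (deriv (deriv f) t) t :=
  ((hf.differentiableOn_deriv t ht).differentiableAt (Ioi_mem_nhds ht)).hasDerivAt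

lemma continuousOn (hf : ClassF f) : ContinuousOn f (Ici 0) := by
  intro t ht
  rcases (mem_Ici.1 ht).eq_or_lt with rfl | ht
  · exact hf.continuousWithinAt_zero
  · exact (hf.hasDerivAt ht).continuousAt.continuousWithinAt

end ClassF

/-- The Bregman divergence `f x - f y - f' y * (x - y)` of `f`. -/
noncomputable def bregman (f : ℝ → ℝ) (x y : ℝ) : ℝ := f x - f y - deriv f y * (x - y)

namespace ClassF

variable {f : ℝ → ℝ}

/-- Since `1 / f''` is concave, `(d, t) ↦ d ^ 2 * f'' t` is jointly convex, as the perspective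
`d ^ 2 / h` of the square at the concave function `h = 1 / f''`. -/
lemma sq_mul_deriv_deriv_le (hf : ClassF f) {a b s t d e : ℝ} (ha : 0 < a) (hb : 0 < b)
    (hab : a + b = 1) (hs : 0 < s) (ht : 0 < t) :
    (a * d + b * e) ^ 2 * deriv (deriv f) (a * s + b * t) ≤
      a * (d ^ 2 * deriv (deriv f) s) + b * (e ^ 2 * deriv (deriv f) t) := by
  have hst : 0 < a * s + b * t := by positivity
  have hc := hf.concaveOn_inv.2 (mem_Ioi.2 hs) (mem_Ioi.2 ht) ha.le hb.le hab
  simp only [smul_eq_mul] at hc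
  have hk₁ := hf.deriv_deriv_pos s hs
  have hk₂ := hf.deriv_deriv_pos t ht
  have hk := hf.deriv_deriv_pos _ hst
  generalize deriv (deriv f) s = k₁ at *
  generalize deriv (deriv f) t = k₂ at *
  generalize deriv (deriv f) (a * s + b * t) = k at *
  -- the Cauchy–Schwarz inequality
  have hcs : (a * d + b * e) ^ 2 ≤
      (a * (d ^ 2 * k₁) + b * (e ^ 2 * k₂)) * (a * (1 / k₁) + b * (1 / k₂)) := by
    have : (a * (d ^ 2 * k₁) + b * (e ^ 2 * k₂)) * (a * (1 / k₁) + b * (1 / k₂)) -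
        (a * d + b * e) ^ 2 = a * b * (d * k₁ - e * k₂) ^ 2 / (k₁ * k₂) := by
      field_simp
      ring
    have : 0 ≤ a * b * (d * k₁ - e * k₂) ^ 2 / (k₁ * k₂) := by positivity
    linarith
  have hX : 0 ≤ a * (d ^ 2 * k₁) + b * (e ^ 2 * k₂) := by positivity
  calc (a * d + b * e) ^ 2 * k
      ≤ ((a * (d ^ 2 * k₁) + b * (e ^ 2 * k₂)) * (1 / k)) * k := by
        gcongr
        exact hcs.trans (mul_le_mul_of_nonneg_left hc hX)
    _ = _ := by field_simp

/-- Joint convexity of the Bregman divergence. Along the path `x = y + s * d`, `s ∈ [0, 1]`, the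
gap in the inequality and its first derivative vanish at `s = 0`, while its second derivative is
nonnegative by `sq_mul_deriv_deriv_le`. -/
lemma bregman_convex (hf : ClassF f) {a b x₀ y₀ x y : ℝ} (ha : 0 < a) (hb : 0 < b)
    (hab : a + b = 1) (hx₀ : 0 < x₀) (hy₀ : 0 < y₀) (hx : 0 < x) (hy : 0 < y) :
    bregman f (a * x₀ + b * x) (a * y₀ + b * y) ≤ a * bregman f x₀ y₀ + b * bregman f x y := by
  have hpos : ∀ {u v : ℝ}, 0 < u → 0 < v → ∀ s ∈ Icc (0 : ℝ) 1, 0 < v + s * (u - v) := by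
    intro u v hu hv s hs
    have : v + s * (u - v) = (1 - s) * v + s * u := by ring
    rw [this]
    rcases hs.1.eq_or_lt with rfl | h
    · simpa using hv
    · have := mul_nonneg (sub_nonneg.2 hs.2) hv.le
      positivity
  have hxm : 0 < a * x₀ + b * x := by positivity
  have hym : 0 < a * y₀ + b * y := by positivity
  have hpath : ∀ u v s : ℝ, HasDerivAt (fun s => v + s * (u - v)) (u - v) s := fun u v s => by
    simpa using ((hasDerivAt_id s).mul_const (u - v)).const_add v
  have hB : ∀ {u v : ℝ}, 0 < u → 0 < v → ∀ s ∈ Icc (0 : ℝ) 1,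
      HasDerivAt (fun s => bregman f (v + s * (u - v)) v)
        ((u - v) * (deriv f (v + s * (u - v)) - deriv f v)) s := by
    intro u v hu hv s hs
    have h1 := (hf.hasDerivAt (hpos hu hv s hs)).comp s (hpath u v s)
    have h2 := ((hpath u v s).sub_const v).const_mul (deriv f v)
    refine ((h1.sub_const (f v)).sub h2).congr_deriv ?_
    ring
  have hD : ∀ {u v : ℝ}, 0 < u → 0 < v → ∀ s ∈ Icc (0 : ℝ) 1,
      HasDerivAt (fun s => (u - v) * (deriv f (v + s * (u - v)) - deriv f v))
        ((u - v) ^ 2 * deriv (deriv f) (v + s * (u - v))) s := by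
    intro u v hu hv s hs
    have h1 := (hf.hasDerivAt_deriv (hpos hu hv s hs)).comp s (hpath u v s)
    refine ((h1.sub_const (deriv f v)).const_mul (u - v)).congr_deriv ?_
    ring
  set xm := a * x₀ + b * x with hxm'
  set ym := a * y₀ + b * y with hym'
  have hΔ' := fun s hs => (((hD hx₀ hy₀ s hs).const_mul a).add ((hD hx hy s hs).const_mul b)).sub
    (hD hxm hym s hs)
  have hΔ := fun s hs => (((hB hx₀ hy₀ s hs).const_mul a).add ((hB hx hy s hs).const_mul b)).sub
    (hB hxm hym s hs)
  have hmono' := monotoneOn_of_deriv_nonneg (convex_Icc (0 : ℝ) 1)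
    (fun s hs => (hΔ' s hs).continuousAt.continuousWithinAt)
    (fun s hs => (hΔ' s (interior_subset hs)).differentiableAt.differentiableWithinAt)
    (fun s hs => by
      rw [(hΔ' s (interior_subset hs)).deriv, sub_nonneg]
      have := hf.sq_mul_deriv_deriv_le (d := x₀ - y₀) (e := x - y) ha hb hab
        (hpos hx₀ hy₀ s (interior_subset hs)) (hpos hx hy s (interior_subset hs))
      convert this using 3
      · rw [hxm', hym']; ring
      · rw [hxm', hym']; ring)
  have hmono := monotoneOn_of_deriv_nonneg (convex_Icc (0 : ℝ) 1)
    (fun s hs => (hΔ s hs).continuousAt.continuousWithinAt)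
    (fun s hs => (hΔ s (interior_subset hs)).differentiableAt.differentiableWithinAt)
    (fun s hs => by
      rw [(hΔ s (interior_subset hs)).deriv]
      have := hmono' (left_mem_Icc.2 zero_le_one) (interior_subset hs) (interior_subset hs).1
      simpa using this)
  have := hmono (left_mem_Icc.2 zero_le_one) (right_mem_Icc.2 zero_le_one) zero_le_one
  simp [bregman] at this
  simp only [bregman]
  linarith

/-- The supporting hyperplane of the Bregman divergence at an interior point. -/
lemma bregman_support_of_pos (hf : ClassF f) {x₀ y₀ x y : ℝ} (hx₀ : 0 < x₀) (hy₀ : 0 < y₀)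
    (hx : 0 < x) (hy : 0 < y) :
    bregman f x₀ y₀ + (deriv f x₀ - deriv f y₀) * (x - x₀) -
      deriv (deriv f) y₀ * (x₀ - y₀) * (y - y₀) ≤ bregman f x y := by
  set φ : ℝ → ℝ := fun t => bregman f (x₀ + t * (x - x₀)) (y₀ + t * (y - y₀)) with hφ
  have hpath : ∀ u v : ℝ, HasDerivAt (fun s : ℝ => v + s * (u - v)) (u - v) 0 := fun u v => by
    simpa using ((hasDerivAt_id (0 : ℝ)).mul_const (u - v)).const_add v
  have h0 : ∀ u v : ℝ, v + 0 * (u - v) = v := fun u v => by ring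
  have hd : HasDerivAt φ ((deriv f x₀ - deriv f y₀) * (x - x₀) -
      deriv (deriv f) y₀ * (x₀ - y₀) * (y - y₀)) 0 := by
    have h1 := HasDerivAt.comp (0 : ℝ) (by rw [h0]; exact hf.hasDerivAt hx₀) (hpath x x₀)
    have h2 := HasDerivAt.comp (0 : ℝ) (by rw [h0]; exact hf.hasDerivAt hy₀) (hpath y y₀)
    have h3 := HasDerivAt.comp (0 : ℝ) (by rw [h0]; exact hf.hasDerivAt_deriv hy₀) (hpath y y₀)
    refine ((h1.sub h2).sub (h3.mul ((hpath x x₀).sub (hpath y y₀)))).congr_deriv ?_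
    simp
    ring
  have hφ0 : φ 0 = bregman f x₀ y₀ := by simp [hφ]
  have hs := (hasDerivAt_iff_tendsto_slope.1 hd).mono_left
    (nhdsWithin_mono (0 : ℝ) (s := Ioi 0) (fun t ht => ne_of_gt (mem_Ioi.1 ht)))
  have hle : (deriv f x₀ - deriv f y₀) * (x - x₀) -
      deriv (deriv f) y₀ * (x₀ - y₀) * (y - y₀) ≤ bregman f x y - bregman f x₀ y₀ := by
    refine le_of_tendsto hs ?_
    filter_upwards [Ioo_mem_nhdsGT (zero_lt_one' ℝ)] with t ht
    rw [slope_def_field, sub_zero, div_le_iff₀ ht.1, hφ0]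
    have := hf.bregman_convex (sub_pos.2 ht.2) ht.1 (by ring) hx₀ hy₀ hx hy
    have e1 : x₀ + t * (x - x₀) = (1 - t) * x₀ + t * x := by ring
    have e2 : y₀ + t * (y - y₀) = (1 - t) * y₀ + t * y := by ring
    simp only [hφ, e1, e2]
    linarith
  linarith

/-- The supporting hyperplane of the Bregman divergence, also at the boundary of the quadrant:
wherever the value of `deriv f` or `deriv (deriv f)` at `0` occurs, which has no meaning, its
coefficient vanishes. -/
lemma bregman_support (hf : ClassF f) {x₀ y₀ x y : ℝ} (hx₀ : 0 ≤ x₀) (hy₀ : 0 ≤ y₀)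
    (hx : 0 ≤ x) (hy : 0 ≤ y) (h₁ : y = 0 → x = 0) (h₂ : x₀ = 0 → x = 0)
    (h₃ : y₀ = 0 → x = 0 ∧ y = 0 ∧ x₀ = 0) :
    bregman f x₀ y₀ + (deriv f x₀ - deriv f y₀) * (x - x₀) -
      deriv (deriv f) y₀ * (x₀ - y₀) * (y - y₀) ≤ bregman f x y := by
  rcases hy₀.eq_or_lt with h | hy₀
  · obtain ⟨rfl, rfl, rfl⟩ := h₃ h.symm
    simp [bregman, ← h]
  -- shift `x`, `y` and `x₀` into the interior by `e`, and let `e` tend to `0`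
  have hshift : ∀ u : ℝ, Filter.Tendsto (fun e : ℝ => u + e) (nhdsWithin 0 (Ioi 0)) (nhds u) := by
    intro u
    have : Filter.Tendsto (fun e : ℝ => u + e) (nhds 0) (nhds (u + 0)) := by
      apply Continuous.tendsto; fun_prop
    rw [add_zero] at this
    exact this.mono_left nhdsWithin_le_nhds
  have hf' : ∀ u : ℝ, 0 ≤ u →
      Filter.Tendsto (fun e : ℝ => f (u + e)) (nhdsWithin 0 (Ioi 0)) (nhds (f u)) := by
    intro u hu
    refine (hf.continuousOn u hu).tendsto.comp (tendsto_nhdsWithin_iff.2 ⟨hshift u, ?_⟩)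
    filter_upwards [self_mem_nhdsWithin] with e he
    exact add_nonneg hu (le_of_lt he)
  have hg : ∀ u v : ℝ, 0 ≤ u → (u = 0 → v = 0) →
      Filter.Tendsto (fun e : ℝ => deriv f (u + e) * v) (nhdsWithin 0 (Ioi 0))
        (nhds (deriv f u * v)) := by
    intro u v hu huv
    rcases hu.eq_or_lt with h | hu
    · simp [huv h.symm]
    · exact ((hf.hasDerivAt_deriv hu).continuousAt.tendsto.comp (hshift u)).mul_const v
  have hL : Filter.Tendsto (fun e : ℝ => (f (x₀ + e) - f y₀ - deriv f y₀ * ((x₀ + e) - y₀)) +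
      (deriv f (x₀ + e) * (x - x₀) - deriv f y₀ * (x - x₀)) -
      deriv (deriv f) y₀ * ((x₀ + e) - y₀) * ((y + e) - y₀)) (nhdsWithin 0 (Ioi 0))
      (nhds ((f x₀ - f y₀ - deriv f y₀ * (x₀ - y₀)) +
      (deriv f x₀ * (x - x₀) - deriv f y₀ * (x - x₀)) -
      deriv (deriv f) y₀ * (x₀ - y₀) * (y - y₀))) :=
    ((((hf' x₀ hx₀).sub_const _).sub (((hshift x₀).sub_const _).const_mul _)).add
      ((hg x₀ (x - x₀) hx₀ (fun h => by rw [h₂ h, h, sub_zero])).sub_const _)).sub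
      ((((hshift x₀).sub_const _).const_mul _).mul ((hshift y).sub_const _))
  have hR : Filter.Tendsto (fun e : ℝ => f (x + e) - f (y + e) - deriv f (y + e) * (x - y))
      (nhdsWithin 0 (Ioi 0)) (nhds (f x - f y - deriv f y * (x - y))) :=
    ((hf' x hx).sub (hf' y hy)).sub (hg y (x - y) hy (fun h => by rw [h₁ h, h, sub_zero]))
  have := le_of_tendsto_of_tendsto hL hR (by
    filter_upwards [self_mem_nhdsWithin] with e he
    have he : 0 < e := he
    have := hf.bregman_support_of_pos (add_pos_of_nonneg_of_pos hx₀ he) hy₀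
      (add_pos_of_nonneg_of_pos hx he) (add_pos_of_nonneg_of_pos hy he)
    simp only [bregman, add_sub_add_right_eq_sub] at this
    linarith)
  simp only [bregman]
  linarith

/-- The tangent inequality on `[0, ∞)`. At `0` the value of `deriv f` has no meaning, and the
inequality is stated only where it does not matter. -/
lemma tangent_le (hf : ClassF f) {x y : ℝ} (hx : 0 ≤ x) (hy : 0 ≤ y) (h : y = 0 → x = 0) :
    f y + deriv f y * (x - y) ≤ f x := by
  have := hf.bregman_support (x₀ := 1) (y₀ := 1) zero_le_one zero_le_one hx hy h (by simp) (by simp)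
  simp only [bregman, sub_self, mul_zero, zero_mul, add_zero] at this
  linarith

end ClassF

/-- The function `f` minus its tangent at `1`, which is nonnegative on `[0, ∞)` and has the same
`f`-divergence. -/
noncomputable def normalized (f : ℝ → ℝ) (x : ℝ) : ℝ := f x - deriv f 1 * (x - 1)

namespace ClassF

variable {f : ℝ → ℝ}

lemma normalized_nonneg (hf : ClassF f) {x : ℝ} (hx : 0 ≤ x) : 0 ≤ normalized f x := by
  have := hf.tangent_le hx zero_le_one (by simp)
  rw [hf.map_one] at this
  rw [normalized]
  linarith

lemma normalized_one (hf : ClassF f) : normalized f 1 = 0 := by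
  simp [normalized, hf.map_one]

lemma normalized (hf : ClassF f) : ClassF (normalized f) := by
  have h1 : ∀ t : ℝ, 0 < t → HasDerivAt (GenBound.normalized f) (deriv f t - deriv f 1) t := by
    intro t ht
    have := (hf.hasDerivAt ht).sub (((hasDerivAt_id t).sub_const 1).const_mul (deriv f 1))
    exact this.congr_deriv (by rw [mul_one])
  have h2 : ∀ t : ℝ, 0 < t →
      HasDerivAt (deriv (GenBound.normalized f)) (deriv (deriv f) t) t := by
    intro t ht
    refine ((hf.hasDerivAt_deriv ht).sub_const (deriv f 1)).congr_of_eventuallyEq ?_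
    filter_upwards [Ioi_mem_nhds ht] with s hs using (h1 s hs).deriv
  refine ⟨?_, ?_, hf.normalized_one, fun t ht => (h1 t ht).differentiableAt.differentiableWithinAt,
    fun t ht => (h2 t ht).differentiableAt.differentiableWithinAt, fun t ht => ?_, ?_⟩
  · refine ⟨convex_Ici 0, fun x hx y hy a b ha hb hab => ?_⟩
    have := hf.convexOn.2 hx hy ha hb hab
    simp only [GenBound.normalized, smul_eq_mul] at this ⊢
    have e : a * x + b * y - 1 = a * (x - 1) + b * (y - 1) := by
      linear_combination hab
    rw [e]
    linarith
  · exact hf.continuousWithinAt_zero.sub (by fun_prop)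
  · rw [(h2 t ht).deriv]
    exact hf.deriv_deriv_pos t ht
  · exact hf.concaveOn_inv.congr (fun t ht => by simp only [(h2 t ht).deriv])

end ClassF
/-! ### Superadditivity of the entropy functional -/

/-- The function `φ` on `[0, ∞]`, for `φ` that is nonnegative on `[0, ∞)`. The value at `∞` is
junk; it is applied to densities, which are finite almost everywhere. -/
noncomputable def ennFun (φ : ℝ → ℝ) (x : ℝ≥0∞) : ℝ≥0∞ := ENNReal.ofReal (φ x.toReal)

lemma ClassF.measurable_comp_toReal {φ : ℝ → ℝ} (hφ : ClassF φ) :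
    Measurable fun x : ℝ≥0∞ => φ x.toReal := by
  have h : Continuous fun t : ℝ => φ (max t 0) :=
    hφ.continuousOn.comp_continuous (by fun_prop) (fun t => le_max_right t 0)
  have : (fun x : ℝ≥0∞ => φ x.toReal) = fun x : ℝ≥0∞ => φ (max x.toReal 0) := by
    ext x
    rw [max_eq_left ENNReal.toReal_nonneg]
  rw [this]
  exact h.measurable.comp ENNReal.measurable_toReal

lemma ClassF.measurable_ennFun {φ : ℝ → ℝ} (hφ : ClassF φ) : Measurable (ennFun φ) :=
  ENNReal.measurable_ofReal.comp hφ.measurable_comp_toReal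

lemma ClassF.measurable_ennFun_comp {φ : ℝ → ℝ} (hφ : ClassF φ) {α : Type*} [MeasurableSpace α]
    {g : α → ℝ≥0∞} (hg : Measurable g) : Measurable fun x => ennFun φ (g x) :=
  hφ.measurable_ennFun.comp hg

/-- Jensen's inequality for an average of `n` terms. -/
lemma natCast_mul_ennFun_le {φ : ℝ → ℝ} (hφ : ClassF φ) (hnn : ∀ x, 0 ≤ x → 0 ≤ φ x)
    {n : ℕ} (hn : 0 < n) {x : Fin n → ℝ≥0∞} (hx : ∀ i, x i ≠ ∞) :
    n * ennFun φ ((n : ℝ≥0∞)⁻¹ * ∑ i, x i) ≤ ∑ i, ennFun φ (x i) := by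
  have hn' : (0 : ℝ) < n := by exact_mod_cast hn
  have h := hφ.convexOn.map_sum_le (t := Finset.univ) (w := fun _ : Fin n => (n : ℝ)⁻¹)
    (p := fun i => (x i).toReal) (fun _ _ => by positivity)
    (by simp [hn'.ne']) (fun i _ => mem_Ici.2 ENNReal.toReal_nonneg)
  simp only [smul_eq_mul, ← Finset.mul_sum] at h
  simp only [ennFun]
  rw [← ENNReal.ofReal_sum_of_nonneg fun i _ => hnn _ ENNReal.toReal_nonneg,
    ← ENNReal.ofReal_natCast, ← ENNReal.ofReal_mul hn'.le]
  refine ENNReal.ofReal_le_ofReal ?_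
  rw [ENNReal.ofReal_natCast, ENNReal.toReal_mul, ENNReal.toReal_inv, ENNReal.toReal_natCast,
    ENNReal.toReal_sum fun i _ => hx i]
  rw [inv_mul_eq_div _ (∑ i, φ _), le_div_iff₀ hn', mul_comm] at h
  exact h

section Entropy

variable {α β : Type*} [MeasurableSpace α] [MeasurableSpace β]

lemma lintegral_ofReal_neg_eq {ν : Measure β} {u : β → ℝ} (hu : Integrable u ν)
    (h : ∫ b, u b ∂ν = 0) :
    ∫⁻ b, ENNReal.ofReal (-u b) ∂ν = ∫⁻ b, ENNReal.ofReal (u b) ∂ν := by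
  rw [integral_eq_lintegral_pos_part_sub_lintegral_neg_part hu, sub_eq_zero] at h
  exact ((ENNReal.toReal_eq_toReal_iff' hu.lintegral_lt_top.ne hu.neg.lintegral_lt_top.ne).1
    h).symm

/-- A function on a product whose sections have integral zero is integrable as soon as it is
bounded above by an integrable function, as its positive and negative parts have equal
integrals. -/
lemma integrable_of_le_of_section_integral_eq_zero {ν₁ : Measure α} {ν₂ : Measure β}
    [SFinite ν₁] [SFinite ν₂] {u v : α × β → ℝ} (hu : Measurable u)
    (hv : Integrable v (ν₁.prod ν₂)) (huv : u ≤ᵐ[ν₁.prod ν₂] v)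
    (h : ∀ᵐ a ∂ν₁, Integrable (fun b => u (a, b)) ν₂ ∧ ∫ b, u (a, b) ∂ν₂ = 0) :
    Integrable u (ν₁.prod ν₂) ∧ ∫ p, u p ∂(ν₁.prod ν₂) = 0 := by
  have hpos : ∫⁻ p, ENNReal.ofReal (u p) ∂(ν₁.prod ν₂) < ∞ :=
    (lintegral_mono_ae (huv.mono fun p hp => ENNReal.ofReal_le_ofReal hp)).trans_lt
      hv.lintegral_lt_top
  have hneg : ∫⁻ p, ENNReal.ofReal (-u p) ∂(ν₁.prod ν₂) =
      ∫⁻ p, ENNReal.ofReal (u p) ∂(ν₁.prod ν₂) := by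
    rw [lintegral_prod _ (by fun_prop), lintegral_prod _ (by fun_prop)]
    exact lintegral_congr_ae (h.mono fun a ha => lintegral_ofReal_neg_eq ha.1 ha.2)
  have hint : Integrable u (ν₁.prod ν₂) := by
    refine ⟨hu.aestronglyMeasurable, ?_⟩
    rw [hasFiniteIntegral_iff_norm]
    have : ∀ p, ENNReal.ofReal ‖u p‖ = ENNReal.ofReal (u p) + ENNReal.ofReal (-u p) := by
      intro p
      rcases le_total 0 (u p) with hp | hp
      · rw [Real.norm_of_nonneg hp, ENNReal.ofReal_of_nonpos (neg_nonpos.2 hp), add_zero]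
      · rw [Real.norm_of_nonpos hp, ENNReal.ofReal_of_nonpos hp, zero_add]
    simp_rw [this]
    rw [lintegral_add_left (by fun_prop), hneg]
    exact ENNReal.add_lt_top.2 ⟨hpos, hpos⟩
  refine ⟨hint, ?_⟩
  rw [integral_prod _ hint]
  exact integral_eq_zero_of_ae (h.mono fun a ha => ha.2)

/-- The mean of `g` over the second coordinate, as a real number. -/
noncomputable def sectionMean (ν₂ : Measure β) (g : α × β → ℝ≥0∞) (a : α) : ℝ :=
  (∫⁻ b, g (a, b) ∂ν₂).toReal

lemma measurable_sectionMean {ν₂ : Measure β} [SFinite ν₂] {g : α × β → ℝ≥0∞}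
    (hg : Measurable g) : Measurable (sectionMean ν₂ g) :=
  hg.lintegral_prod_right'.ennreal_toReal

section SectionMean

variable {ν₁ : Measure α} {ν₂ : Measure β} [IsProbabilityMeasure ν₂] {g : α × β → ℝ≥0∞}

lemma integrable_sectionMean (hg : Measurable g) (hfin : ∫⁻ p, g p ∂(ν₁.prod ν₂) ≠ ∞) :
    Integrable (sectionMean ν₂ g) ν₁ ∧
      ∫ a, sectionMean ν₂ g a ∂ν₁ = (∫⁻ p, g p ∂(ν₁.prod ν₂)).toReal := by
  rw [lintegral_prod _ hg.aemeasurable] at hfin ⊢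
  have hm := hg.lintegral_prod_right' (ν := ν₂)
  exact ⟨integrable_toReal_of_lintegral_ne_top hm.aemeasurable hfin,
    integral_toReal hm.aemeasurable (ae_lt_top hm hfin)⟩

lemma ae_section (hg : Measurable g) (hfin : ∫⁻ p, g p ∂(ν₁.prod ν₂) ≠ ∞) :
    ∀ᵐ a ∂ν₁, Integrable (fun b => (g (a, b)).toReal) ν₂ ∧
      ∫ b, (g (a, b)).toReal ∂ν₂ = sectionMean ν₂ g a := by
  rw [lintegral_prod _ hg.aemeasurable] at hfin
  filter_upwards [ae_lt_top (hg.lintegral_prod_right' (ν := ν₂)) hfin] with a ha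
  have hm : Measurable fun b => g (a, b) := hg.comp measurable_prodMk_left
  exact ⟨integrable_toReal_of_lintegral_ne_top hm.aemeasurable ha.ne,
    integral_toReal hm.aemeasurable (ae_lt_top hm ha.ne)⟩

lemma ae_sectionMean_eq_zero [SFinite ν₁] (hg : Measurable g)
    (hfin : ∫⁻ p, g p ∂(ν₁.prod ν₂) ≠ ∞) :
    ∀ᵐ p ∂(ν₁.prod ν₂), sectionMean ν₂ g p.1 = 0 → (g p).toReal = 0 := by
  have hX : Measurable fun p => (g p).toReal := hg.ennreal_toReal
  have hY := measurable_sectionMean (ν₂ := ν₂) hg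
  have hmeas : MeasurableSet {p : α × β | sectionMean ν₂ g p.1 = 0 → (g p).toReal = 0} := by
    have h1 : MeasurableSet {p : α × β | sectionMean ν₂ g p.1 = 0} :=
      measurableSet_eq_fun (by fun_prop) measurable_const
    have h2 : MeasurableSet {p : α × β | (g p).toReal = 0} :=
      measurableSet_eq_fun hX measurable_const
    exact h1.imp h2
  rw [Measure.ae_prod_iff_ae_ae hmeas]
  filter_upwards [ae_section hg hfin] with a ha
  by_cases h : sectionMean ν₂ g a = 0
  · have := (integral_eq_zero_iff_of_nonneg (fun b => ENNReal.toReal_nonneg) ha.1).1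
      (ha.2.trans h)
    exact this.mono fun b hb _ => hb
  · exact Filter.Eventually.of_forall fun b hb => absurd hb h

/-- The tangent inequality at the section means: its linear term is integrable with integral
zero, and the function of the section means is integrable. -/
lemma integrable_tangent [IsProbabilityMeasure ν₁] {φ : ℝ → ℝ} (hφ : ClassF φ)
    (hnn : ∀ x, 0 ≤ x → 0 ≤ φ x) (hg : Measurable g) (hfin : ∫⁻ p, g p ∂(ν₁.prod ν₂) ≠ ∞)
    (hint : Integrable (fun p => φ (g p).toReal) (ν₁.prod ν₂)) :
    Integrable (fun p => deriv φ (sectionMean ν₂ g p.1) * ((g p).toReal - sectionMean ν₂ g p.1))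
        (ν₁.prod ν₂) ∧
      ∫ p, deriv φ (sectionMean ν₂ g p.1) * ((g p).toReal - sectionMean ν₂ g p.1)
        ∂(ν₁.prod ν₂) = 0 ∧
      Integrable (fun a => φ (sectionMean ν₂ g a)) ν₁ := by
  have hX : Measurable fun p => (g p).toReal := hg.ennreal_toReal
  have hY := measurable_sectionMean (ν₂ := ν₂) hg
  have hd := measurable_deriv φ
  have hYφ : Measurable fun a => φ (sectionMean ν₂ g a) :=
    hφ.measurable_comp_toReal.comp (hg.lintegral_prod_right' (ν := ν₂))
  have hle : ∀ᵐ p ∂(ν₁.prod ν₂), φ (sectionMean ν₂ g p.1) +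
      deriv φ (sectionMean ν₂ g p.1) * ((g p).toReal - sectionMean ν₂ g p.1) ≤
        φ (g p).toReal := by
    filter_upwards [ae_sectionMean_eq_zero hg hfin] with p hp
    exact hφ.tangent_le ENNReal.toReal_nonneg ENNReal.toReal_nonneg hp
  obtain ⟨h1, h2⟩ := integrable_of_le_of_section_integral_eq_zero (ν₁ := ν₁) (ν₂ := ν₂)
    (u := fun p => deriv φ (sectionMean ν₂ g p.1) * ((g p).toReal - sectionMean ν₂ g p.1))
    (by fun_prop) hint
    (hle.mono fun p hp => by
      have := hnn (sectionMean ν₂ g p.1) ENNReal.toReal_nonneg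
      dsimp only
      linarith)
    ((ae_section hg hfin).mono fun a ha =>
      ⟨(ha.1.sub (integrable_const (sectionMean ν₂ g a))).const_mul
          (deriv φ (sectionMean ν₂ g a)), by
        dsimp only
        rw [integral_const_mul, integral_sub ha.1 (integrable_const _), ha.2]
        simp⟩)
  refine ⟨h1, h2, ?_⟩
  have h3 : Integrable (fun p : α × β => φ (sectionMean ν₂ g p.1)) (ν₁.prod ν₂) := by
    refine (hint.sub h1).mono' (hYφ.comp measurable_fst).aestronglyMeasurable ?_
    filter_upwards [hle] with p hp
    rw [Real.norm_of_nonneg (hnn (sectionMean ν₂ g p.1) ENNReal.toReal_nonneg)]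
    simp only [Pi.sub_apply]
    linarith
  exact (measurePreserving_fst (μ := ν₁) (ν := ν₂)).integrable_comp
    hYφ.aestronglyMeasurable |>.1 h3

/-- Superadditivity of the entropy functional on a product of two probability spaces, by
integration of the supporting-hyperplane inequality for the Bregman divergence of a value of `g`
and its mean over the second coordinate, at the mean over the first coordinate and the total
mean. All linear terms integrate to zero. -/
lemma entropy_superadditive_prod [IsProbabilityMeasure ν₁] {φ : ℝ → ℝ} (hφ : ClassF φ)
    (hnn : ∀ x, 0 ≤ x → 0 ≤ φ x) (hg : Measurable g) (hfin : ∫⁻ p, g p ∂(ν₁.prod ν₂) ≠ ∞) :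
    ∫⁻ a, ennFun φ (∫⁻ b, g (a, b) ∂ν₂) ∂ν₁ + ∫⁻ b, ennFun φ (∫⁻ a, g (a, b) ∂ν₁) ∂ν₂ ≤
      ∫⁻ p, ennFun φ (g p) ∂(ν₁.prod ν₂) + ennFun φ (∫⁻ p, g p ∂(ν₁.prod ν₂)) := by
  by_cases htop : ∫⁻ p, ennFun φ (g p) ∂(ν₁.prod ν₂) = ∞
  · simp [htop]
  have hXφ : Measurable fun p => φ (g p).toReal := hφ.measurable_comp_toReal.comp hg
  have hint : Integrable (fun p => φ (g p).toReal) (ν₁.prod ν₂) :=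
    (lintegral_ofReal_ne_top_iff_integrable hXφ.aestronglyMeasurable
      (Filter.Eventually.of_forall fun p => hnn _ ENNReal.toReal_nonneg)).1 htop
  -- the exchange of the two coordinates
  have hg' : Measurable fun p : β × α => g p.swap := hg.comp measurable_swap
  have hswap : ∫⁻ p : β × α, g p.swap ∂(ν₂.prod ν₁) = ∫⁻ p, g p ∂(ν₁.prod ν₂) :=
    lintegral_prod_swap g
  have hfin' : ∫⁻ p : β × α, g p.swap ∂(ν₂.prod ν₁) ≠ ∞ := by rwa [hswap]
  obtain ⟨hu, hu0, hφY⟩ := integrable_tangent hφ hnn hg hfin hint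
  obtain ⟨hv, hv0, hφX₀⟩ := integrable_tangent hφ hnn hg' hfin' hint.swap
  obtain ⟨hY, hYm⟩ := integrable_sectionMean hg hfin
  obtain ⟨hX₀, hX₀m⟩ := integrable_sectionMean hg' hfin'
  rw [hswap] at hX₀m
  have hz := ae_sectionMean_eq_zero hg hfin
  have hz' : ∀ᵐ p ∂(ν₁.prod ν₂),
      sectionMean ν₁ (fun p : β × α => g p.swap) p.2 = 0 → (g p).toReal = 0 :=
    (Measure.measurePreserving_swap (μ := ν₁) (ν := ν₂)).quasiMeasurePreserving.ae
      (ae_sectionMean_eq_zero hg' hfin')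
  have hv' := hv.swap
  have hv0' := (integral_prod_swap (μ := ν₂) (ν := ν₁) (fun p : β × α =>
    deriv φ (sectionMean ν₁ (fun p : β × α => g p.swap) p.1) *
      ((g p.swap).toReal - sectionMean ν₁ (fun p : β × α => g p.swap) p.1))).trans hv0
  simp only [Function.comp_def, Prod.fst_swap, Prod.swap_swap] at hv' hv0'
  set y₀ := (∫⁻ p, g p ∂(ν₁.prod ν₂)).toReal with hy₀
  set Y := sectionMean ν₂ g
  set X₀ := sectionMean ν₁ (fun p : β × α => g p.swap)
  have hXint : Integrable (fun p => (g p).toReal) (ν₁.prod ν₂) :=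
    integrable_toReal_of_lintegral_ne_top hg.aemeasurable hfin
  have hXm : ∫ p, (g p).toReal ∂(ν₁.prod ν₂) = y₀ :=
    integral_toReal hg.aemeasurable (ae_lt_top hg hfin)
  have hle : ∀ᵐ p ∂(ν₁.prod ν₂),
      (φ (Y p.1) + φ (X₀ p.2)) + (deriv φ (X₀ p.2) * ((g p).toReal - X₀ p.2) +
        deriv φ (Y p.1) * ((g p).toReal - Y p.1) - deriv φ y₀ * ((g p).toReal - y₀) -
        deriv (deriv φ) y₀ * ((Y p.1 - y₀) * (X₀ p.2 - y₀))) ≤ φ (g p).toReal + φ y₀ := by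
    have hzero : y₀ = 0 → ∀ᵐ p ∂(ν₁.prod ν₂), (g p).toReal = 0 ∧ Y p.1 = 0 ∧ X₀ p.2 = 0 := by
      intro h
      have h1 := (integral_eq_zero_iff_of_nonneg (fun p => ENNReal.toReal_nonneg) hXint).1
        (hXm.trans h)
      have h2 := (integral_eq_zero_iff_of_nonneg (fun p => ENNReal.toReal_nonneg) hY).1
        (hYm.trans h)
      have h3 := (integral_eq_zero_iff_of_nonneg (fun p => ENNReal.toReal_nonneg) hX₀).1
        (hX₀m.trans h)
      filter_upwards [h1, Measure.quasiMeasurePreserving_fst.ae h2,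
        Measure.quasiMeasurePreserving_snd.ae h3] with p a b c using ⟨a, b, c⟩
    have hzero' : ∀ᵐ p ∂(ν₁.prod ν₂), y₀ = 0 → (g p).toReal = 0 ∧ Y p.1 = 0 ∧ X₀ p.2 = 0 := by
      by_cases h : y₀ = 0
      · exact (hzero h).mono fun p hp _ => hp
      · exact Filter.Eventually.of_forall fun p hp => absurd hp h
    filter_upwards [hz, hz', hzero'] with p h1 h2 h3
    have := hφ.bregman_support (x₀ := X₀ p.2) (y₀ := y₀) (x := (g p).toReal) (y := Y p.1)
      ENNReal.toReal_nonneg ENNReal.toReal_nonneg ENNReal.toReal_nonneg ENNReal.toReal_nonneg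
      h1 h2 h3
    simp only [bregman] at this
    linarith
  have hφY₂ : Integrable (fun p : α × β => φ (Y p.1)) (ν₁.prod ν₂) := hφY.comp_fst ν₂
  have hφX₀₂ : Integrable (fun p : α × β => φ (X₀ p.2)) (ν₁.prod ν₂) := hφX₀.comp_snd ν₁
  have hprod : Integrable (fun p : α × β => (Y p.1 - y₀) * (X₀ p.2 - y₀)) (ν₁.prod ν₂) :=
    (hY.sub (integrable_const y₀)).mul_prod (hX₀.sub (integrable_const y₀))
  have hprod0 : ∫ p : α × β, (Y p.1 - y₀) * (X₀ p.2 - y₀) ∂(ν₁.prod ν₂) = 0 := by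
    rw [integral_prod_mul (fun a => Y a - y₀) (fun b => X₀ b - y₀),
      integral_sub hY (integrable_const y₀), hYm]
    simp
  have hconst := ((hXint.sub (integrable_const y₀)).const_mul (deriv φ y₀))
  have hconst0 : ∫ p, deriv φ y₀ * ((g p).toReal - y₀) ∂(ν₁.prod ν₂) = 0 := by
    rw [integral_const_mul, integral_sub hXint (integrable_const y₀), hXm]
    simp
  have hreal : ∫ a, φ (Y a) ∂ν₁ + ∫ b, φ (X₀ b) ∂ν₂ ≤
      ∫ p, φ (g p).toReal ∂(ν₁.prod ν₂) + φ y₀ := by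
    have h := integral_mono_ae ((hφY₂.add hφX₀₂).add (((hv'.add hu).sub hconst).sub
      (hprod.const_mul (deriv (deriv φ) y₀)))) (hint.add (integrable_const (φ y₀))) hle
    rw [integral_add' (hφY₂.add hφX₀₂) (((hv'.add hu).sub hconst).sub (hprod.const_mul _)),
      integral_add' hφY₂ hφX₀₂, integral_sub' ((hv'.add hu).sub hconst) (hprod.const_mul _),
      integral_sub' (hv'.add hu) hconst, integral_add' hv' hu,
      integral_add' hint (integrable_const _)] at h
    simp only [Pi.sub_apply] at h
    rw [hv0', hu0, hconst0, integral_const_mul, hprod0, integral_const,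
      integral_fun_fst (μ := ν₁) (ν := ν₂) (fun a => φ (Y a)),
      integral_fun_snd (μ := ν₁) (ν := ν₂) (fun b => φ (X₀ b))] at h
    simpa using h
  have e1 : ∫⁻ a, ennFun φ (∫⁻ b, g (a, b) ∂ν₂) ∂ν₁ = ENNReal.ofReal (∫ a, φ (Y a) ∂ν₁) :=
    (ofReal_integral_eq_lintegral_ofReal hφY
      (Filter.Eventually.of_forall fun a => hnn _ ENNReal.toReal_nonneg)).symm
  have e2 : ∫⁻ b, ennFun φ (∫⁻ a, g (a, b) ∂ν₁) ∂ν₂ = ENNReal.ofReal (∫ b, φ (X₀ b) ∂ν₂) :=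
    (ofReal_integral_eq_lintegral_ofReal hφX₀
      (Filter.Eventually.of_forall fun a => hnn _ ENNReal.toReal_nonneg)).symm
  have e3 : ∫⁻ p, ennFun φ (g p) ∂(ν₁.prod ν₂) =
      ENNReal.ofReal (∫ p, φ (g p).toReal ∂(ν₁.prod ν₂)) :=
    (ofReal_integral_eq_lintegral_ofReal hint
      (Filter.Eventually.of_forall fun a => hnn _ ENNReal.toReal_nonneg)).symm
  have hY0 : 0 ≤ ∫ a, φ (Y a) ∂ν₁ := integral_nonneg fun a => hnn _ ENNReal.toReal_nonneg
  have hX₀0 : 0 ≤ ∫ b, φ (X₀ b) ∂ν₂ := integral_nonneg fun a => hnn _ ENNReal.toReal_nonneg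
  have hX0 : 0 ≤ ∫ p, φ (g p).toReal ∂(ν₁.prod ν₂) :=
    integral_nonneg fun a => hnn _ ENNReal.toReal_nonneg
  rw [e1, e2, e3, ennFun, ← hy₀, ← ENNReal.ofReal_add hY0 hX₀0,
    ← ENNReal.ofReal_add hX0 (hnn _ ENNReal.toReal_nonneg)]
  exact ENNReal.ofReal_le_ofReal hreal

end SectionMean
end Entropy

section Pi

variable {Z : Type*} [MeasurableSpace Z] {μ : Measure Z} [IsProbabilityMeasure μ]

lemma measurable_fin_cons {Z : Type*} [MeasurableSpace Z] {n : ℕ} :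
    Measurable fun p : Z × (Fin n → Z) => (Fin.cons p.1 p.2 : Fin (n + 1) → Z) := by
  refine measurable_pi_iff.2 fun i => Fin.cases ?_ (fun j => ?_) i
  · simpa using measurable_fst
  · simp only [Fin.cons_succ]
    fun_prop

lemma lintegral_pi_succ {n : ℕ} {h : (Fin (n + 1) → Z) → ℝ≥0∞} (hh : Measurable h) :
    ∫⁻ s, h s ∂(Measure.pi fun _ => μ) =
      ∫⁻ p : Z × (Fin n → Z), h (Fin.cons p.1 p.2) ∂(μ.prod (Measure.pi fun _ => μ)) := by
  rw [← (measurePreserving_piFinSuccAbove (fun _ : Fin (n + 1) => μ) 0).symm.lintegral_comp hh]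
  simp [MeasurableEquiv.piFinSuccAbove, Fin.insertNthEquiv]

lemma measurable_update_prodMk {Z : Type*} [MeasurableSpace Z] {n : ℕ} (i : Fin n) :
    Measurable fun p : Z × (Fin n → Z) => Function.update p.2 i p.1 := by
  refine measurable_pi_iff.2 fun j => ?_
  by_cases h : j = i
  · subst h; simpa using measurable_fst
  · simp only [Function.update_of_ne h]
    fun_prop

/-- Replacing one of `n` i.i.d. samples by a fresh one. -/
lemma measurePreserving_update {n : ℕ} (i : Fin n) :
    MeasurePreserving (fun p : Z × (Fin n → Z) => Function.update p.2 i p.1)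
      (μ.prod (Measure.pi fun _ => μ)) (Measure.pi fun _ => μ) := by
  have hm := measurable_update_prodMk (Z := Z) i
  refine ⟨hm, (Measure.pi_eq fun A hA => ?_).symm⟩
  rw [Measure.map_apply hm (MeasurableSet.univ_pi hA)]
  have : (fun p : Z × (Fin n → Z) => Function.update p.2 i p.1) ⁻¹' univ.pi A =
      A i ×ˢ univ.pi (Function.update A i univ) := by
    ext ⟨z, s⟩
    simp only [mem_preimage, mem_prod, mem_univ_pi]
    constructor
    · intro h
      refine ⟨by simpa using h i, fun j => ?_⟩
      by_cases hj : j = i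
      · subst hj; simp
      · simpa [Function.update_of_ne hj] using h j
    · rintro ⟨h1, h2⟩ j
      by_cases hj : j = i
      · subst hj; simpa using h1
      · simpa [Function.update_of_ne hj] using h2 j
  rw [this, Measure.prod_prod, Measure.pi_pi, ← Finset.mul_prod_erase _ _ (Finset.mem_univ i),
    ← Finset.mul_prod_erase _ (fun j => μ (A j)) (Finset.mem_univ i), Function.update_self,
    measure_univ, one_mul]
  congr 1
  refine Finset.prod_congr rfl fun j hj => ?_
  rw [Function.update_of_ne (Finset.ne_of_mem_erase hj)]

/-- Superadditivity of the entropy functional on `n` i.i.d. samples: the entropies of the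
conditional means of `g` given the single samples add up to at most the entropy of `g`. -/
lemma entropy_superadditive_pi {φ : ℝ → ℝ} (hφ : ClassF φ) (hnn : ∀ x, 0 ≤ x → 0 ≤ φ x)
    {n : ℕ} {g : (Fin n → Z) → ℝ≥0∞} (hg : Measurable g)
    (hfin : ∫⁻ s, g s ∂(Measure.pi fun _ => μ) ≠ ∞) :
    ∑ i, ∫⁻ z, ennFun φ (∫⁻ s, g (Function.update s i z) ∂(Measure.pi fun _ => μ)) ∂μ +
        ennFun φ (∫⁻ s, g s ∂(Measure.pi fun _ => μ)) ≤
      ∫⁻ s, ennFun φ (g s) ∂(Measure.pi fun _ => μ) +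
        n * ennFun φ (∫⁻ s, g s ∂(Measure.pi fun _ => μ)) := by
  induction n with
  | zero =>
    simp [Measure.pi_of_empty (fun _ : Fin 0 => μ) default]
  | succ n ih =>
    have hG : Measurable fun p : Z × (Fin n → Z) => g (Fin.cons p.1 p.2) :=
      hg.comp measurable_fin_cons
    have hg' : Measurable fun s : Fin n → Z => ∫⁻ a, g (Fin.cons a s) ∂μ :=
      hG.lintegral_prod_left'
    have hmean : ∫⁻ s, g s ∂(Measure.pi fun _ => μ) =
        ∫⁻ s : Fin n → Z, ∫⁻ a, g (Fin.cons a s) ∂μ ∂(Measure.pi fun _ => μ) := by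
      rw [lintegral_pi_succ hg, lintegral_prod_symm' _ hG]
    have h0 : ∀ z, ∫⁻ s, g (Function.update s 0 z) ∂(Measure.pi fun _ => μ) =
        ∫⁻ s : Fin n → Z, g (Fin.cons z s) ∂(Measure.pi fun _ => μ) := by
      intro z
      have hm : Measurable fun s : Fin (n + 1) → Z => g (Function.update s 0 z) :=
        hg.comp ((measurable_update_prodMk 0).comp measurable_prodMk_left)
      have hm' := hm.comp measurable_fin_cons
      rw [lintegral_pi_succ hm]
      simp only [Function.comp_def, Fin.update_cons_zero] at hm' ⊢
      rw [lintegral_prod_symm' _ hm']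
      simp
    have hs : ∀ (i : Fin n) z, ∫⁻ s, g (Function.update s i.succ z) ∂(Measure.pi fun _ => μ) =
        ∫⁻ s : Fin n → Z, ∫⁻ a, g (Fin.cons a (Function.update s i z)) ∂μ
          ∂(Measure.pi fun _ => μ) := by
      intro i z
      have hm : Measurable fun s : Fin (n + 1) → Z => g (Function.update s i.succ z) :=
        hg.comp ((measurable_update_prodMk i.succ).comp measurable_prodMk_left)
      have hm' := hm.comp measurable_fin_cons
      rw [lintegral_pi_succ hm]
      simp only [Function.comp_def, ← Fin.cons_update] at hm' ⊢
      rw [lintegral_prod_symm' _ hm']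
    have hpair := entropy_superadditive_prod (ν₁ := μ) (ν₂ := Measure.pi fun _ : Fin n => μ)
      hφ hnn hG (by rwa [← lintegral_pi_succ hg])
    have hih := ih hg' (by rwa [← hmean])
    rw [← lintegral_pi_succ hg,
      ← lintegral_pi_succ (hφ.measurable_ennFun_comp hg)] at hpair
    rw [← hmean] at hih
    rw [Fin.sum_univ_succ]
    simp only [h0, hs]
    set E := ennFun φ (∫⁻ s, g s ∂(Measure.pi fun _ => μ))
    rw [add_assoc]
    refine (add_le_add_right hih _).trans ?_
    rw [← add_assoc]
    refine (add_le_add_left hpair _).trans ?_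
    rw [Nat.cast_succ, add_mul, one_mul, add_assoc, add_comm E]

/-- The entropy of the average of the conditional means of `g` given the single samples is at most
`1 / n` times the entropy of `g`. As in the superadditivity lemmas, the entropy
`∫ φ (g) - φ (∫ g)` is written without subtraction, since its first term may be infinite. -/
lemma entropy_average_le {φ : ℝ → ℝ} (hφ : ClassF φ) (hnn : ∀ x, 0 ≤ x → 0 ≤ φ x)
    {n : ℕ} (hn : 0 < n) {g : (Fin n → Z) → ℝ≥0∞} (hg : Measurable g)
    (hfin : ∫⁻ s, g s ∂(Measure.pi fun _ => μ) ≠ ∞) :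
    n * ∫⁻ z, ennFun φ ((n : ℝ≥0∞)⁻¹ *
          ∑ i, ∫⁻ s, g (Function.update s i z) ∂(Measure.pi fun _ => μ)) ∂μ +
        ennFun φ (∫⁻ s, g s ∂(Measure.pi fun _ => μ)) ≤
      ∫⁻ s, ennFun φ (g s) ∂(Measure.pi fun _ => μ) +
        n * ennFun φ (∫⁻ s, g s ∂(Measure.pi fun _ => μ)) := by
  refine le_trans ?_ (entropy_superadditive_pi hφ hnn hg hfin)
  gcongr
  have hm : ∀ i, Measurable fun z => ∫⁻ s, g (Function.update s i z) ∂(Measure.pi fun _ => μ) :=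
    fun i => (hg.comp (measurable_update_prodMk i)).lintegral_prod_right'
  have hm' : ∀ i, Measurable fun z =>
      ennFun φ (∫⁻ s, g (Function.update s i z) ∂(Measure.pi fun _ => μ)) :=
    fun i => hφ.measurable_ennFun_comp (hm i)
  have hfin' : ∀ᵐ z ∂μ, ∀ i, ∫⁻ s, g (Function.update s i z) ∂(Measure.pi fun _ => μ) < ∞ := by
    refine ae_all_iff.2 fun i => ae_lt_top (hm i) ?_
    rw [← lintegral_prod (fun p : Z × (Fin n → Z) => g (Function.update p.2 i p.1))
      (hg.comp (measurable_update_prodMk i)).aemeasurable,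
      (measurePreserving_update i).lintegral_comp hg]
    exact hfin
  rw [← lintegral_const_mul' _ _ (ENNReal.natCast_ne_top n),
    ← lintegral_finsetSum _ fun i _ => hm' i]
  refine lintegral_mono_ae ?_
  filter_upwards [hfin'] with z hz using natCast_mul_ennFun_le hφ hnn hn fun i => (hz i).ne

end Pi
/-! ### The divergence as an integral over a density -/

lemma fDiv_withDensity {f : ℝ → ℝ} (hf : ClassF f) {X : Type*} [MeasurableSpace X] {m : Measure X}
    [IsProbabilityMeasure m] {G : X → ℝ≥0∞} (hG : Measurable G)
    [IsProbabilityMeasure (m.withDensity G)] :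
    fDiv f (m.withDensity G) m = ∫⁻ x, ennFun (normalized f) (G x) ∂m := by
  have h1 : ∫⁻ x, G x ∂m = 1 := by
    rw [← setLIntegral_univ, ← withDensity_apply _ MeasurableSet.univ, measure_univ]
  have hGi : Integrable (fun x => (G x).toReal) m :=
    integrable_toReal_of_lintegral_ne_top hG.aemeasurable (by simp [h1])
  have hG1 : ∫ x, (G x).toReal ∂m = 1 := by
    rw [integral_toReal hG.aemeasurable (ae_lt_top hG (by simp [h1])), h1, ENNReal.toReal_one]
  have hr : (fun x => f ((m.withDensity G).rnDeriv m x).toReal) =ᵐ[m] fun x => f (G x).toReal := by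
    filter_upwards [Measure.rnDeriv_withDensity m hG] with x hx
    rw [hx]
  have hlin : Integrable (fun x => deriv f 1 * ((G x).toReal - 1)) m :=
    (hGi.sub (integrable_const 1)).const_mul _
  have hlin0 : ∫ x, deriv f 1 * ((G x).toReal - 1) ∂m = 0 := by
    rw [integral_const_mul, integral_sub hGi (integrable_const 1), hG1]
    simp
  have hn : (fun x => normalized f (G x).toReal) =
      fun x => f (G x).toReal - deriv f 1 * ((G x).toReal - 1) := rfl
  have hn0 : 0 ≤ᵐ[m] fun x => normalized f (G x).toReal :=
    Filter.Eventually.of_forall fun x => hf.normalized_nonneg ENNReal.toReal_nonneg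
  have hmeas : AEStronglyMeasurable (fun x => normalized f (G x).toReal) m :=
    (hf.normalized.measurable_comp_toReal.comp hG).aestronglyMeasurable
  rw [fDiv]
  split_ifs with hac
  · have hi : Integrable (fun x => f (G x).toReal) m := (integrable_congr hr).1 hac.2
    have hi' : Integrable (fun x => normalized f (G x).toReal) m := hi.sub hlin
    rw [integral_congr_ae hr, show ∫ x, f (G x).toReal ∂m = ∫ x, normalized f (G x).toReal ∂m by
      rw [hn, integral_sub hi hlin, hlin0, sub_zero]]
    exact ofReal_integral_eq_lintegral_ofReal hi' hn0
  · by_contra hne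
    have hi' := (lintegral_ofReal_ne_top_iff_integrable hmeas hn0).1 (Ne.symm hne)
    refine hac ⟨withDensity_absolutelyContinuous m G, (integrable_congr hr).2
      ((hi'.add hlin).congr (Filter.Eventually.of_forall fun x => ?_))⟩
    simp [normalized]

lemma fDiv_of_not_ac {f : ℝ → ℝ} {X : Type*} [MeasurableSpace X] {P Q : Measure X}
    (h : ¬ P ≪ Q) : fDiv f P Q = ∞ := by
  simp [fDiv, h]

lemma fDiv_self {f : ℝ → ℝ} (hf : ClassF f) {X : Type*} [MeasurableSpace X] (P : Measure X)
    [IsProbabilityMeasure P] : fDiv f P P = 0 := by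
  have h : P.withDensity (fun _ => 1) = P := withDensity_one
  have : IsProbabilityMeasure (P.withDensity fun _ => 1) := by rw [h]; infer_instance
  have := fDiv_withDensity hf (m := P) (G := fun _ => 1) measurable_const
  rw [h] at this
  rw [this]
  simp [ennFun, hf.normalized_one]

/-! ### The averaged single-sample kernel -/

lemma genGap_eq {Z W : Type*} [MeasurableSpace Z] {μ : Measure Z} {n : ℕ}
    {ℓ : W → Z → ℝ} (hn : 0 < n) (w : W) (s : Fin n → Z) :
    genGap ℓ μ w s = (n : ℝ)⁻¹ * ∑ i, genGapOne ℓ μ w (s i) := by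
  have : (n : ℝ) ≠ 0 := Nat.cast_ne_zero.2 hn.ne'
  simp only [genGap, genGapOne, empRisk, Finset.sum_sub_distrib, Finset.sum_const,
    Finset.card_univ, Fintype.card_fin, nsmul_eq_mul]
  field_simp

section Averaged

variable {Z W : Type*} [MeasurableSpace Z] [MeasurableSpace W]

/-- The single-sample kernel that puts the sample `z` at a uniformly chosen position `i` of a data
set whose other entries are drawn from `μ`, and runs the algorithm `κ` on it. Its law at `z` is
the average over `i` of the conditional laws of the output given `Z_i = z`. -/
noncomputable def averagedKernel {n : ℕ} (μ : Measure Z) [SigmaFinite μ]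
    (κ : Kernel (Fin n → Z) W) : Kernel Z W where
  toFun z := (n : ℝ≥0∞)⁻¹ •
    ∑ i, (Measure.pi fun _ => μ).bind fun s => κ (Function.update s i z)
  measurable' := by
    refine Measure.measurable_of_measurable_coe _ fun A hA => ?_
    simp only [Measure.smul_apply, Measure.finsetSum_apply, smul_eq_mul]
    refine (Finset.measurable_fun_sum _ fun i _ => ?_).const_mul _
    have : ∀ z, ((Measure.pi fun _ => μ).bind fun s => κ (Function.update s i z)) A =
        ∫⁻ s, κ (Function.update s i z) A ∂(Measure.pi fun _ => μ) := fun z =>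
      Measure.bind_apply hA (κ.measurable.comp
        ((measurable_update_prodMk i).comp measurable_prodMk_left)).aemeasurable
    simp only [this]
    exact ((κ.measurable_coe hA).comp (measurable_update_prodMk i)).lintegral_prod_right'

lemma averagedKernel_apply {n : ℕ} (μ : Measure Z) [SigmaFinite μ] (κ : Kernel (Fin n → Z) W)
    (z : Z) {A : Set W} (hA : MeasurableSet A) :
    averagedKernel μ κ z A = (n : ℝ≥0∞)⁻¹ *
      ∑ i, ∫⁻ s, κ (Function.update s i z) A ∂(Measure.pi fun _ => μ) := by
  have : ∀ i, ((Measure.pi fun _ => μ).bind fun s => κ (Function.update s i z)) A =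
      ∫⁻ s, κ (Function.update s i z) A ∂(Measure.pi fun _ => μ) := fun i =>
    Measure.bind_apply hA (κ.measurable.comp
      ((measurable_update_prodMk i).comp measurable_prodMk_left)).aemeasurable
  simp [averagedKernel, this]

variable {μ : Measure Z} [IsProbabilityMeasure μ] {n : ℕ} {κ : Kernel (Fin n → Z) W}

lemma isMarkovKernel_averagedKernel [IsMarkovKernel κ] (hn : 0 < n) :
    IsMarkovKernel (averagedKernel μ κ) := by
  refine ⟨fun z => ⟨?_⟩⟩
  rw [averagedKernel_apply μ κ z MeasurableSet.univ]
  simp [ENNReal.inv_mul_cancel (Nat.cast_ne_zero.2 hn.ne') (ENNReal.natCast_ne_top n)]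

lemma jointLawOne_averagedKernel [IsMarkovKernel κ] (hn : 0 < n) :
    jointLawOne μ (averagedKernel μ κ) =
      (n : ℝ≥0∞)⁻¹ • ∑ i, (jointLaw μ κ).map fun p => (p.1 i, p.2) := by
  have := isMarkovKernel_averagedKernel (μ := μ) (κ := κ) hn
  ext A hA
  rw [jointLawOne, Measure.compProd_apply hA]
  have hsec : ∀ z, MeasurableSet (Prod.mk z ⁻¹' A : Set W) := fun z => measurable_prodMk_left hA
  simp only [averagedKernel_apply _ _ _ (hsec _), Measure.smul_apply, Measure.finsetSum_apply,
    smul_eq_mul]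
  have hpre : ∀ i : Fin n, MeasurableSet ((fun p : (Fin n → Z) × W => (p.1 i, p.2)) ⁻¹' A) :=
    fun i => (by fun_prop : Measurable fun p : (Fin n → Z) × W => (p.1 i, p.2)) hA
  have hm : ∀ i : Fin n, Measurable fun p : Z × (Fin n → Z) =>
      κ (Function.update p.2 i p.1) (Prod.mk p.1 ⁻¹' A) := by
    intro i
    have := (Kernel.measurable_kernel_prodMk_left (κ := κ) (hpre i)).comp
      (measurable_update_prodMk i)
    simpa [Function.comp_def, preimage_preimage] using this
  have hm' : ∀ i : Fin n, Measurable fun z =>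
      ∫⁻ s, κ (Function.update s i z) (Prod.mk z ⁻¹' A) ∂(Measure.pi fun _ => μ) :=
    fun i => (hm i).lintegral_prod_right'
  rw [lintegral_const_mul _ (Finset.measurable_fun_sum _ fun i _ => hm' i),
    lintegral_finsetSum _ fun i _ => hm' i]
  congr 1
  refine Finset.sum_congr rfl fun i _ => ?_
  rw [Measure.map_apply (by fun_prop) hA, jointLaw, Measure.compProd_apply (hpre i),
    ← (measurePreserving_update (μ := μ) i).lintegral_comp
      (Kernel.measurable_kernel_prodMk_left (hpre i)), ← lintegral_prod _ (hm i).aemeasurable]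
  simp [preimage_preimage]

lemma jointLaw_fst [IsMarkovKernel κ] : (jointLaw μ κ).fst = Measure.pi fun _ => μ :=
  Measure.fst_compProd _ _

instance [IsMarkovKernel κ] : IsProbabilityMeasure (jointLaw μ κ) := by
  unfold jointLaw; infer_instance

instance (κ : Kernel Z W) [IsMarkovKernel κ] : IsProbabilityMeasure (jointLawOne μ κ) := by
  unfold jointLawOne; infer_instance

lemma snd_jointLawOne_averagedKernel [IsMarkovKernel κ] (hn : 0 < n) :
    (jointLawOne μ (averagedKernel μ κ)).snd = (jointLaw μ κ).snd := by
  ext A hA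
  rw [jointLawOne_averagedKernel hn, Measure.snd_apply hA, Measure.snd_apply hA]
  have : ∀ i : Fin n, ((jointLaw μ κ).map fun p => (p.1 i, p.2)) (Prod.snd ⁻¹' A) =
      jointLaw μ κ (Prod.snd ⁻¹' A) := fun i => by
    rw [Measure.map_apply (by fun_prop) (measurable_snd hA)]
    rfl
  simp only [Measure.smul_apply, Measure.finsetSum_apply, this]
  simp [← mul_assoc, ENNReal.inv_mul_cancel (Nat.cast_ne_zero.2 hn.ne') (ENNReal.natCast_ne_top n)]

/-- The average over `i` of the conditional means of a density `G` given `Z_i = z`. -/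
noncomputable def averagedDensity (μ : Measure Z) (G : (Fin n → Z) × W → ℝ≥0∞) (p : Z × W) :
    ℝ≥0∞ :=
  (n : ℝ≥0∞)⁻¹ * ∑ i, ∫⁻ s, G (Function.update s i p.1, p.2) ∂(Measure.pi fun _ => μ)

lemma measurable_conditionalMean {G : (Fin n → Z) × W → ℝ≥0∞} (hG : Measurable G) (i : Fin n) :
    Measurable fun p : Z × W =>
      ∫⁻ s, G (Function.update s i p.1, p.2) ∂(Measure.pi fun _ => μ) := by
  have : Measurable fun q : (Z × W) × (Fin n → Z) => G (Function.update q.2 i q.1.1, q.1.2) :=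
    hG.comp (((measurable_update_prodMk i).comp (measurable_fst.fst.prodMk measurable_snd)).prodMk
      measurable_fst.snd)
  exact this.lintegral_prod_right'

lemma measurable_averagedDensity {G : (Fin n → Z) × W → ℝ≥0∞} (hG : Measurable G) :
    Measurable (averagedDensity μ G) :=
  (Finset.measurable_fun_sum _ fun i _ => measurable_conditionalMean hG i).const_mul _

lemma jointLawOne_averagedKernel_eq_withDensity [IsMarkovKernel κ] (hn : 0 < n) {Q : Measure W}
    [SFinite Q] {G : (Fin n → Z) × W → ℝ≥0∞} (hG : Measurable G)
    (hP : jointLaw μ κ = ((Measure.pi fun _ => μ).prod Q).withDensity G) :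
    jointLawOne μ (averagedKernel μ κ) = (μ.prod Q).withDensity (averagedDensity μ G) := by
  rw [jointLawOne_averagedKernel hn]
  ext A hA
  rw [withDensity_apply _ hA, ← lintegral_indicator hA]
  have hmi := fun i => measurable_conditionalMean (μ := μ) hG i
  have e : ∀ p, A.indicator (averagedDensity μ G) p = (n : ℝ≥0∞)⁻¹ *
      ∑ i, A.indicator (fun p : Z × W =>
        ∫⁻ s, G (Function.update s i p.1, p.2) ∂(Measure.pi fun _ => μ)) p := by
    intro p
    by_cases hp : p ∈ A <;> simp [hp, averagedDensity]
  simp only [e]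
  rw [lintegral_const_mul _ (Finset.measurable_fun_sum _ fun i _ => (hmi i).indicator hA),
    lintegral_finsetSum _ fun i _ => (hmi i).indicator hA]
  simp only [Measure.smul_apply, Measure.finsetSum_apply, smul_eq_mul]
  congr 1
  refine Finset.sum_congr rfl fun i _ => ?_
  have hpm : Measurable fun p : (Fin n → Z) × W => (p.1 i, p.2) := by fun_prop
  rw [Measure.map_apply hpm hA, hP, withDensity_apply _ (hpm hA), ← lintegral_indicator (hpm hA),
    lintegral_prod_symm' _ (hG.indicator (hpm hA)), lintegral_prod_symm' _ ((hmi i).indicator hA)]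
  refine lintegral_congr fun w => ?_
  have hw : Measurable fun s : Fin n → Z =>
      ((fun p : (Fin n → Z) × W => (p.1 i, p.2)) ⁻¹' A).indicator G (s, w) :=
    (hG.indicator (hpm hA)).comp measurable_prodMk_right
  rw [← (measurePreserving_update (μ := μ) i).lintegral_comp hw]
  have := (hw.comp (measurable_update_prodMk i)).aemeasurable (μ := μ.prod (Measure.pi fun _ => μ))
  simp only [Function.comp_def] at this
  rw [lintegral_prod _ this]
  refine lintegral_congr fun z => ?_
  by_cases hz : (z, w) ∈ A <;> simp [indicator, hz]

/-- The marginal of `(X × Q).withDensity G` on the second factor. -/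
lemma snd_prod_withDensity {X : Type*} [MeasurableSpace X] {m : Measure X} {Q : Measure W}
    [SFinite m] [SFinite Q] {G : X × W → ℝ≥0∞} (hG : Measurable G) :
    ((m.prod Q).withDensity G).snd = Q.withDensity fun w => ∫⁻ x, G (x, w) ∂m := by
  ext A hA
  have hpm := (measurable_snd : Measurable (Prod.snd : X × W → W)) hA
  rw [Measure.snd_apply hA, withDensity_apply _ hpm, withDensity_apply _ hA,
    ← lintegral_indicator hpm, lintegral_prod_symm' _ (hG.indicator hpm), ← lintegral_indicator hA]
  refine lintegral_congr fun w => ?_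
  by_cases hw : w ∈ A <;> simp [indicator, hw]

/-- The chain-rule form of superadditivity: with the same reference law `Q` of the output, the
divergence of the averaged single-sample kernel in excess of the divergence of the output law is
at most `1 / n` of that of the algorithm. -/
lemma natCast_mul_fDiv_averagedKernel_le {f : ℝ → ℝ} (hf : ClassF f) [IsMarkovKernel κ]
    (hn : 0 < n) (Q : Measure W) [IsProbabilityMeasure Q] :
    n * fDiv f (jointLawOne μ (averagedKernel μ κ)) (μ.prod Q) + fDiv f (jointLaw μ κ).snd Q ≤
      fDiv f (jointLaw μ κ) ((Measure.pi fun _ => μ).prod Q) +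
        n * fDiv f (jointLaw μ κ).snd Q := by
  by_cases hac : jointLaw μ κ ≪ (Measure.pi fun _ => μ).prod Q
  swap
  · simp [fDiv_of_not_ac hac]
  have := isMarkovKernel_averagedKernel (μ := μ) (κ := κ) hn
  set G := (jointLaw μ κ).rnDeriv ((Measure.pi fun _ => μ).prod Q)
  have hG : Measurable G := Measure.measurable_rnDeriv _ _
  have hP : jointLaw μ κ = ((Measure.pi fun _ => μ).prod Q).withDensity G :=
    (Measure.withDensity_rnDeriv_eq _ _ hac).symm
  have hP1 := jointLawOne_averagedKernel_eq_withDensity hn hG hP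
  have hP2 : (jointLaw μ κ).snd = Q.withDensity fun w => ∫⁻ s, G (s, w) ∂(Measure.pi fun _ => μ) :=
    (congrArg Measure.snd hP).trans (snd_prod_withDensity hG)
  have hGw : Measurable fun w => ∫⁻ s, G (s, w) ∂(Measure.pi fun _ => μ) :=
    hG.lintegral_prod_left'
  have hφ := hf.normalized
  have hnn : ∀ x, 0 ≤ x → 0 ≤ normalized f x := fun x hx => hf.normalized_nonneg hx
  have d0 : fDiv f (jointLaw μ κ) ((Measure.pi fun _ => μ).prod Q) =
      ∫⁻ w, ∫⁻ s, ennFun (normalized f) (G (s, w)) ∂(Measure.pi fun _ => μ) ∂Q := by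
    have : IsProbabilityMeasure (((Measure.pi fun _ => μ).prod Q).withDensity G) := by
      rw [← hP]; infer_instance
    rw [hP, fDiv_withDensity hf hG, lintegral_prod_symm' _ (hφ.measurable_ennFun_comp hG)]
  have d1 : fDiv f (jointLawOne μ (averagedKernel μ κ)) (μ.prod Q) =
      ∫⁻ w, ∫⁻ z, ennFun (normalized f) (averagedDensity μ G (z, w)) ∂μ ∂Q := by
    have : IsProbabilityMeasure ((μ.prod Q).withDensity (averagedDensity μ G)) := by
      rw [← hP1]; infer_instance
    rw [hP1, fDiv_withDensity hf (measurable_averagedDensity hG),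
      lintegral_prod_symm' _ (hφ.measurable_ennFun_comp (measurable_averagedDensity hG))]
  have d2 : fDiv f (jointLaw μ κ).snd Q =
      ∫⁻ w, ennFun (normalized f) (∫⁻ s, G (s, w) ∂(Measure.pi fun _ => μ)) ∂Q := by
    have : IsProbabilityMeasure
        (Q.withDensity fun w => ∫⁻ s, G (s, w) ∂(Measure.pi fun _ => μ)) := by
      rw [← hP2]; infer_instance
    rw [hP2, fDiv_withDensity hf hGw]
  have hGfin : ∀ᵐ w ∂Q, ∫⁻ s, G (s, w) ∂(Measure.pi fun _ => μ) < ∞ := by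
    refine ae_lt_top hGw ?_
    rw [← setLIntegral_univ, ← withDensity_apply _ MeasurableSet.univ, ← hP2]
    exact measure_ne_top _ _
  rw [d0, d1, d2, ← lintegral_const_mul' _ _ (ENNReal.natCast_ne_top n),
    ← lintegral_const_mul' _ _ (ENNReal.natCast_ne_top n),
    ← lintegral_add_right _ (hφ.measurable_ennFun_comp hGw),
    ← lintegral_add_right _ ((hφ.measurable_ennFun_comp hGw).const_mul _)]
  refine lintegral_mono_ae ?_
  filter_upwards [hGfin] with w hw
  exact entropy_average_le hφ hnn hn (g := fun s => G (s, w)) (hG.comp measurable_prodMk_right)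
    hw.ne

/-- The averaged single-sample kernel carries at most `1 / n` of the mutual information. -/
lemma mutualInfo_averagedKernel_le {f : ℝ → ℝ} (hf : ClassF f) [IsMarkovKernel κ] (hn : 0 < n)
    (k : InfoKind) :
    mutualInfo k f (jointLawOne μ (averagedKernel μ κ)) ≤ mutualInfo k f (jointLaw μ κ) / n := by
  have := isMarkovKernel_averagedKernel (μ := μ) (κ := κ) hn
  have hfst : (jointLawOne μ (averagedKernel μ κ)).fst = μ := Measure.fst_compProd _ _
  have hsnd := snd_jointLawOne_averagedKernel (μ := μ) (κ := κ) hn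
  have hn0 : (n : ℝ≥0∞) ≠ 0 := Nat.cast_ne_zero.2 hn.ne'
  rw [ENNReal.le_div_iff_mul_le (Or.inl hn0) (Or.inl (ENNReal.natCast_ne_top n)), mul_comm]
  cases k with
  | CKZ =>
    have h := natCast_mul_fDiv_averagedKernel_le (μ := μ) hf hn (κ := κ) (jointLaw μ κ).snd
    rw [fDiv_self hf] at h
    simpa [mutualInfo, hfst, hsnd, jointLaw_fst] using h
  | MBGYA =>
    simp only [mutualInfo, hfst, hsnd, jointLaw_fst]
    refine le_iInf₂ fun Q hQ => le_iInf₂ fun hQac hQfin => ?_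
    have h := natCast_mul_fDiv_averagedKernel_le (μ := μ) hf hn (κ := κ) Q
    refine (mul_le_mul_right (iInf₂_le_of_le Q hQ (iInf₂_le hQac hQfin)) _).trans ?_
    rw [ENNReal.mul_sub (fun _ _ => ENNReal.natCast_ne_top n)]
    -- both differences may truncate, but the bound survives without data processing
    rw [tsub_le_iff_right]
    exact (ENNReal.le_sub_of_add_le_right hQfin h).trans add_tsub_le_tsub_add

lemma measurable_genGapOne {ℓ : W → Z → ℝ} (hℓ : Measurable fun p : W × Z => ℓ p.1 p.2) :
    Measurable fun p : Z × W => genGapOne ℓ μ p.2 p.1 := by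
  have h1 : Measurable (popRisk ℓ μ) :=
    (hℓ.stronglyMeasurable.integral_prod_right (ν := μ)).measurable
  exact (h1.comp measurable_snd).sub (hℓ.comp measurable_swap)

lemma isAlgorithmOne_averagedKernel {ℓ : W → Z → ℝ} (hℓ : Measurable fun p : W × Z => ℓ p.1 p.2)
    (hn : 0 < n) (hκ : IsAlgorithm ℓ μ κ) :
    IsAlgorithmOne ℓ μ (averagedKernel μ κ) ∧
      genErrorOne ℓ μ (averagedKernel μ κ) = genError ℓ μ κ := by
  have := hκ.isMarkovKernel
  have hgm := measurable_genGapOne (μ := μ) hℓ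
  have hpm : ∀ i : Fin n, Measurable fun p : (Fin n → Z) × W => (p.1 i, p.2) := fun i => by
    fun_prop
  have hint : ∀ i : Fin n, Integrable (fun p : Z × W => genGapOne ℓ μ p.2 p.1)
      ((jointLaw μ κ).map fun p => (p.1 i, p.2)) := fun i =>
    (integrable_map_measure hgm.aestronglyMeasurable (hpm i).aemeasurable).2 (hκ.integrable i)
  refine ⟨⟨isMarkovKernel_averagedKernel hn, ?_⟩, ?_⟩
  · rw [jointLawOne_averagedKernel hn]
    exact (integrable_finsetSum_measure.2 fun i _ => hint i).smul_measure
      (by simpa using hn.ne')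
  · rw [genErrorOne, genError, jointLawOne_averagedKernel hn, integral_smul_measure,
      integral_finsetSum_measure fun i _ => hint i]
    simp only [genGap_eq hn]
    rw [integral_const_mul, integral_finsetSum _ fun i _ => hκ.integrable i, smul_eq_mul,
      ENNReal.toReal_inv, ENNReal.toReal_natCast]
    congr 1
    refine Finset.sum_congr rfl fun i _ => ?_
    rw [integral_map (hpm i).aemeasurable hgm.aestronglyMeasurable]

end Averaged

/-! ### Barycenters and Carathéodory reduction -/

/-- In finite dimension, a convex set and a point outside it are weakly separated, even if the set
is not closed. The functionals of norm one that separate the point from a given finite subset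
form a nonempty closed subset of the compact unit sphere. -/
lemma exists_ne_zero_forall_le_of_notMem_convex {V : Type*} [NormedAddCommGroup V]
    [NormedSpace ℝ V] [FiniteDimensional ℝ V] {C : Set V} (hC : Convex ℝ C) (hne : C.Nonempty)
    {m : V} (hm : m ∉ C) : ∃ u : V →L[ℝ] ℝ, u ≠ 0 ∧ ∀ c ∈ C, u c ≤ u m := by
  classical
  obtain ⟨c₀, hc₀⟩ := hne
  have : ProperSpace (V →L[ℝ] ℝ) := FiniteDimensional.proper ℝ _
  have hcl : ∀ c : C, IsClosed {u : V →L[ℝ] ℝ | u c ≤ u m} := fun c =>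
    isClosed_le (by fun_prop) (by fun_prop)
  obtain ⟨u, hu, huC⟩ := (isCompact_sphere (0 : V →L[ℝ] ℝ) 1).inter_iInter_nonempty _ hcl (by
    intro F
    set K : Set V := convexHull ℝ (insert c₀ (Subtype.val '' (F : Set C)))
    have hfin : (insert c₀ (Subtype.val '' (F : Set C)) : Set V).Finite :=
      (F.finite_toSet.image _).insert _
    have hsub : insert c₀ (Subtype.val '' (F : Set C)) ⊆ C := by
      rintro _ (rfl | ⟨c, -, rfl⟩)
      exacts [hc₀, c.2]
    obtain ⟨g, r, hg, hr⟩ := geometric_hahn_banach_closed_point (convex_convexHull ℝ _)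
      (hfin.isCompact_convexHull ℝ).isClosed fun h => hm (convexHull_min hsub hC h)
    have hle : ∀ c ∈ insert c₀ (Subtype.val '' (F : Set C)), g c < g m := fun c hc =>
      (hg c (subset_convexHull ℝ _ hc)).trans hr
    have hg0 : 0 < ‖g‖ := by
      refine norm_pos_iff.2 fun h => ?_
      have := hle c₀ (mem_insert _ _)
      simp [h] at this
    refine ⟨‖g‖⁻¹ • g, by simp [norm_smul, hg0.ne'], mem_iInter₂.2 fun c hc => ?_⟩
    have := (hle c (mem_insert_of_mem _ ⟨c, hc, rfl⟩)).le
    simpa using mul_le_mul_of_nonneg_left this (inv_nonneg.2 hg0.le))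
  refine ⟨u, fun h => by simp [h] at hu, fun c hc => mem_iInter.1 huC ⟨c, hc⟩⟩

/-- The mean of a random vector in a finite-dimensional space lies in the convex hull, not only in
the closed convex hull, of every set that carries it. Otherwise a functional separates the two
weakly, the vector lies almost surely in a hyperplane, and the dimension drops. -/
lemma integral_mem_convexHull {Ω : Type*} [MeasurableSpace Ω] {ν : Measure Ω}
    [IsProbabilityMeasure ν] : ∀ {V : Type*} [NormedAddCommGroup V] [NormedSpace ℝ V]
    [FiniteDimensional ℝ V] {φ : Ω → V}, Integrable φ ν → ∀ {S : Set V}, (∀ᵐ x ∂ν, φ x ∈ S) →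
    ∫ x, φ x ∂ν ∈ convexHull ℝ S := by
  intro V _ _ _
  induction hd : Module.finrank ℝ V using Nat.strong_induction_on generalizing V with
  | _ d ih =>
  intro φ hφ S hS
  by_contra hm
  set m := ∫ x, φ x ∂ν with hmdef
  obtain ⟨x₀, hx₀⟩ := hS.exists
  obtain ⟨u, hu0, hu⟩ := exists_ne_zero_forall_le_of_notMem_convex (convex_convexHull ℝ S)
    ⟨_, subset_convexHull ℝ _ hx₀⟩ hm
  have huφ : Integrable (fun x => u m - u (φ x)) ν :=
    (integrable_const _).sub (u.integrable_comp hφ)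
  have huz : ∀ᵐ x ∂ν, u m - u (φ x) = 0 := by
    refine (integral_eq_zero_iff_of_nonneg_ae (hS.mono fun x hx =>
      sub_nonneg.2 (hu _ (subset_convexHull ℝ _ hx))) huφ).1 ?_
    rw [integral_sub (integrable_const _) (u.integrable_comp hφ), u.integral_comp_comm hφ]
    simp [hmdef]
  set K : Submodule ℝ V := LinearMap.ker (u : V →ₗ[ℝ] ℝ) with hK
  have hKlt : Module.finrank ℝ K < d := by
    rw [← hd]
    refine Submodule.finrank_lt fun h => hu0 ?_
    ext v
    have : v ∈ K := h ▸ Submodule.mem_top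
    simpa [hK] using this
  obtain ⟨π, hπ⟩ := K.subtype.exists_leftInverse_of_injective K.ker_subtype
  have hπ' : ∀ v ∈ K, (π v : V) = v := fun v hv => by
    have := LinearMap.congr_fun hπ ⟨v, hv⟩
    simpa using congrArg Subtype.val this
  have hφm : Integrable (fun x => φ x - m) ν := hφ.sub (integrable_const m)
  set πc : V →L[ℝ] K := LinearMap.toContinuousLinearMap π
  have hint : ∫ x, πc (φ x - m) ∂ν = 0 := by
    rw [πc.integral_comp_comm hφm, integral_sub hφ (integrable_const m)]
    simp [hmdef]
  have h0 : (0 : K) ∈ convexHull ℝ {v : K | m + v ∈ S} := by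
    rw [← hint]
    refine ih _ hKlt rfl (πc.integrable_comp hφm) ?_
    filter_upwards [hS, huz] with x hx hux
    have : φ x - m ∈ K := by
      rw [hK, LinearMap.mem_ker]
      simp only [ContinuousLinearMap.coe_coe, map_sub]
      linarith
    change m + (π (φ x - m) : V) ∈ S
    rw [hπ' _ this]
    simpa using hx
  have hconv : Convex ℝ {v : K | m + v ∈ convexHull ℝ S} :=
    ((convex_convexHull ℝ S).translate_preimage_right m).linear_preimage K.subtype
  have hsub : {v : K | m + v ∈ S} ⊆ {v : K | m + v ∈ convexHull ℝ S} :=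
    fun v hv => subset_convexHull ℝ S hv
  have : m + ((0 : K) : V) ∈ convexHull ℝ S := convexHull_min hsub hconv h0
  exact hm (by simpa using this)

/-- A basic solution of a linear program. A nonnegative combination of vectors that lie in an
affine hyperplane off the origin can be replaced by one with at most as many terms as the
dimension, without decreasing a given linear objective. If there are more terms, some linear
relation between the vectors does not decrease the objective, and it has a negative coefficient;
moving along it makes some weight vanish. -/
lemma exists_basic_solution {W V : Type*} [AddCommGroup V] [Module ℝ V] [FiniteDimensional ℝ V]
    (Ψ : W → V) (c : W → ℝ) (e : V →ₗ[ℝ] ℝ) (T : Finset W) (q : W → ℝ)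
    (hq : ∀ w ∈ T, 0 ≤ q w) (he : ∀ w ∈ T, e (Ψ w) = 1) :
    ∃ T' ⊆ T, ∃ q' : W → ℝ, T'.card ≤ Module.finrank ℝ V ∧ (∀ w ∈ T', 0 ≤ q' w) ∧
      ∑ w ∈ T', q' w • Ψ w = ∑ w ∈ T, q w • Ψ w ∧
      ∑ w ∈ T, q w * c w ≤ ∑ w ∈ T', q' w * c w := by
  classical
  induction T using Finset.strongInduction generalizing q with
  | H T ih =>
  by_cases hcard : T.card ≤ Module.finrank ℝ V
  · exact ⟨T, subset_rfl, q, hcard, hq, rfl, le_rfl⟩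
  obtain ⟨v, hv, hvc, w₀, hw₀, hvw₀⟩ : ∃ v : W → ℝ, ∑ w ∈ T, v w • Ψ w = 0 ∧
      0 ≤ ∑ w ∈ T, v w * c w ∧ ∃ w ∈ T, v w ≠ 0 := by
    obtain ⟨v, hv, hv0⟩ : ∃ v : W → ℝ, ∑ w ∈ T, v w • Ψ w = 0 ∧ ∃ w ∈ T, v w ≠ 0 := by
      have hli : ¬ LinearIndependent ℝ fun w : T => Ψ w := fun h =>
        hcard (by simpa using h.fintype_card_le_finrank)
      obtain ⟨g, hg, ⟨w, hw⟩, hgw⟩ := Fintype.not_linearIndependent_iff.1 hli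
      refine ⟨fun w => if h : w ∈ T then g ⟨w, h⟩ else 0, ?_, w, hw, by simpa [hw] using hgw⟩
      rw [← Finset.sum_coe_sort]
      simpa using hg
    rcases le_total 0 (∑ w ∈ T, v w * c w) with h | h
    · exact ⟨v, hv, h, hv0⟩
    · refine ⟨fun w => -v w, ?_, ?_, ?_⟩
      · simpa using hv
      · simpa using h
      · simpa using hv0
  have hvsum : ∑ w ∈ T, v w = 0 := by
    have := congrArg e hv
    simp only [map_sum, map_smul, map_zero, smul_eq_mul] at this
    rw [← this]
    exact Finset.sum_congr rfl fun w hw => by rw [he w hw, mul_one]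
  obtain ⟨w₁, hw₁, hvw₁⟩ : ∃ w ∈ T, v w < 0 := by
    by_contra! h
    exact hvw₀ ((Finset.sum_eq_zero_iff_of_nonneg h).1 hvsum w₀ hw₀)
  obtain ⟨w₂, hw₂, hmin⟩ := (T.filter fun w => v w < 0).exists_min_image (fun w => q w / -v w)
    ⟨w₁, by simp [hw₁, hvw₁]⟩
  simp only [Finset.mem_filter] at hw₂ hmin
  set t := q w₂ / -v w₂ with ht
  have ht0 : 0 ≤ t := div_nonneg (hq _ hw₂.1) (by linarith [hw₂.2])
  have hq₂ : q w₂ + t * v w₂ = 0 := by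
    have := hw₂.2.ne
    rw [ht]
    field_simp
    ring
  have hq' : ∀ w ∈ T, 0 ≤ q w + t * v w := by
    intro w hw
    rcases lt_or_ge (v w) 0 with h | h
    · have := hmin w ⟨hw, h⟩
      rw [le_div_iff₀ (by linarith)] at this
      linarith
    · have := hq w hw
      positivity
  obtain ⟨T', hT', q', h1, h2, h3, h4⟩ := ih (T.erase w₂) (Finset.erase_ssubset hw₂.1)
    (fun w => q w + t * v w) (fun w hw => hq' w (Finset.mem_of_mem_erase hw))
    (fun w hw => he w (Finset.mem_of_mem_erase hw))
  refine ⟨T', hT'.trans (Finset.erase_subset _ _), q', h1, h2, ?_, ?_⟩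
  · rw [h3, Finset.sum_erase _ (by simp only [hq₂, zero_smul])]
    simp only [add_smul, Finset.sum_add_distrib, mul_smul, ← Finset.smul_sum, hv]
    simp
  · refine le_trans ?_ h4
    rw [Finset.sum_erase _ (by simp only [hq₂, zero_mul])]
    simp only [add_mul, Finset.sum_add_distrib, mul_assoc, ← Finset.mul_sum]
    have := mul_nonneg ht0 hvc
    linarith

/-- The mean of a random vector is a convex combination of finitely many of its values. -/
lemma exists_finset_sum_eq_integral {W : Type*} [MeasurableSpace W] {ν : Measure W}
    [IsProbabilityMeasure ν] {V : Type*} [NormedAddCommGroup V] [NormedSpace ℝ V]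
    [FiniteDimensional ℝ V] {Φ : W → V} (hΦ : Integrable Φ ν) {S : Set W}
    (hS : ∀ᵐ w ∂ν, w ∈ S) :
    ∃ (T : Finset W) (q : W → ℝ), (T : Set W) ⊆ S ∧ (∀ w, 0 ≤ q w) ∧
      ∑ w ∈ T, q w • Φ w = ∫ w, Φ w ∂ν := by
  classical
  have h := integral_mem_convexHull hΦ (S := Φ '' S) (hS.mono fun w hw => mem_image_of_mem _ hw)
  obtain ⟨ι, _, p, x, hp, -, hx, hsum⟩ := mem_convexHull_iff_exists_fintype.1 h
  choose y hyS hy using hx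
  refine ⟨Finset.univ.image y, fun w => ∑ i with y i = w, p i, ?_, fun w =>
    Finset.sum_nonneg fun i _ => hp i, ?_⟩
  · intro w hw
    obtain ⟨i, -, rfl⟩ := Finset.mem_image.1 hw
    exact hyS i
  · rw [← hsum, ← Finset.sum_fiberwise_of_maps_to (s := Finset.univ) (t := Finset.univ.image y)
      (g := y) (fun i _ => Finset.mem_image_of_mem _ (Finset.mem_univ i))]
    refine Finset.sum_congr rfl fun w _ => ?_
    rw [Finset.sum_smul]
    refine Finset.sum_congr rfl fun i hi => ?_
    rw [← hy i, (Finset.mem_filter.1 hi).2]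

/-- Discretization of a probability measure, by at most as many atoms as the dimension, that keeps
the mean of a vector-valued function with values in an affine hyperplane off the origin, and does
not decrease the mean of a real function. -/
lemma exists_discretization {W : Type*} [MeasurableSpace W] {ν : Measure W}
    [IsProbabilityMeasure ν] {V : Type*} [NormedAddCommGroup V] [NormedSpace ℝ V]
    [FiniteDimensional ℝ V] {Ψ : W → V} (hΨ : Integrable Ψ ν) {c : W → ℝ} (hc : Integrable c ν)
    {S : Set W} (hS : ∀ᵐ w ∂ν, w ∈ S) (e : V →ₗ[ℝ] ℝ) (he : ∀ w ∈ S, e (Ψ w) = 1) :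
    ∃ (T : Finset W) (q : W → ℝ), (T : Set W) ⊆ S ∧ T.card ≤ Module.finrank ℝ V ∧
      (∀ w ∈ T, 0 ≤ q w) ∧ ∑ w ∈ T, q w • Ψ w = ∫ w, Ψ w ∂ν ∧
      ∫ w, c w ∂ν ≤ ∑ w ∈ T, q w * c w := by
  obtain ⟨T, q, hTS, hq, hsum⟩ := exists_finset_sum_eq_integral (hΨ.prodMk hc) hS
  obtain ⟨T', hT', q', h1, h2, h3, h4⟩ := exists_basic_solution Ψ c e T q (fun w _ => hq w)
    fun w hw => he w (hTS hw)
  have hs1 : ∑ w ∈ T, q w • Ψ w = ∫ w, Ψ w ∂ν := by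
    have := congrArg Prod.fst hsum
    simpa [Prod.fst_sum, fst_integral (hΨ.prodMk hc)] using this
  have hs2 : ∑ w ∈ T, q w * c w = ∫ w, c w ∂ν := by
    have := congrArg Prod.snd hsum
    simpa [Prod.snd_sum, snd_integral (hΨ.prodMk hc)] using this
  exact ⟨T', q', (Finset.coe_subset.2 hT').trans hTS, h1, h2, h3.trans hs1, hs2 ▸ h4⟩

/-! ### Finitely supported output on a finite sample space -/

section FiniteSupport

lemma ae_measure_singleton_ne_zero {Z : Type*} [MeasurableSpace Z] [Finite Z] {μ : Measure Z} :
    ∀ᵐ z ∂μ, μ {z} ≠ 0 := by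
  rw [ae_iff]
  have : {z | ¬ μ {z} ≠ 0} = ⋃ z ∈ {z | μ {z} = 0}, {z} := by
    ext z; simp
  rw [this, measure_biUnion_null_iff (Set.to_countable _)]
  exact fun z hz => hz

variable {Z W : Type*} [MeasurableSpace Z] [MeasurableSpace W] {μ : Measure Z}

lemma of_ae_of_measure_singleton_ne_zero {p : Z → Prop} (hp : ∀ᵐ z ∂μ, p z) {z : Z}
    (hz : μ {z} ≠ 0) : p z := by
  by_contra h
  exact hz (measure_mono_null (singleton_subset_iff.2 h) hp)

/-- A density with respect to a product measure has sections of mean one if the marginal is the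
second factor. -/
lemma ae_lintegral_eq_one_of_snd {m : Measure Z} {Q : Measure W} [SFinite m] [SigmaFinite Q]
    {G : Z × W → ℝ≥0∞} (hG : Measurable G) (h : ((m.prod Q).withDensity G).snd = Q) :
    ∀ᵐ w ∂Q, ∫⁻ z, G (z, w) ∂m = 1 := by
  rw [snd_prod_withDensity hG] at h
  conv_rhs at h => rw [← withDensity_one (μ := Q)]
  exact (withDensity_eq_iff_of_sigmaFinite hG.lintegral_prod_left'.aemeasurable
    measurable_one.aemeasurable).1 h

lemma ae_lintegral_eq_one_of_fst {m : Measure Z} {Q : Measure W} [SigmaFinite m] [SFinite Q]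
    {G : Z × W → ℝ≥0∞} (hG : Measurable G) (h : ((m.prod Q).withDensity G).fst = m) :
    ∀ᵐ z ∂m, ∫⁻ w, G (z, w) ∂Q = 1 := by
  refine ae_lintegral_eq_one_of_snd (m := Q) (Q := m) (hG.comp measurable_swap) ?_
  conv_rhs => rw [← h]
  ext A hA
  have hA₁ := (measurable_fst : Measurable (Prod.fst : Z × W → Z)) hA
  have hA₂ := (measurable_snd : Measurable (Prod.snd : W × Z → Z)) hA
  rw [Measure.snd_apply hA, Measure.fst_apply hA, withDensity_apply _ hA₁,
    withDensity_apply _ hA₂, ← lintegral_indicator hA₁, ← lintegral_indicator hA₂,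
    ← lintegral_prod_swap]
  rfl

/-- On a finite sample space the joint law has a density with respect to the product of its
marginals. -/
lemma jointLawOne_absolutelyContinuous [Finite Z] [SFinite μ] (κ : Kernel Z W) [IsMarkovKernel κ] :
    jointLawOne μ κ ≪ μ.prod (jointLawOne μ κ).snd := by
  have hsnd : (jointLawOne μ κ).snd = κ ∘ₘ μ := Measure.snd_compProd _ _
  rw [jointLawOne, ← Measure.compProd_const]
  refine Measure.AbsolutelyContinuous.compProd_right ?_
  filter_upwards [ae_measure_singleton_ne_zero] with z hz
  rw [Kernel.const_apply]
  refine Measure.AbsolutelyContinuous.mk fun B hB hB0 => ?_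
  change (jointLawOne μ κ).snd B = 0 at hB0
  rw [hsnd, Measure.bind_apply hB κ.aemeasurable,
    lintegral_eq_zero_iff (κ.measurable_coe hB)] at hB0
  by_contra h
  exact hz (measure_mono_null (singleton_subset_iff.2 h) hB0)

/-- The law `∑ w ∈ T, q w • δ_w`. -/
noncomputable def discreteLaw (T : Finset W) (q : W → ℝ) : Measure W :=
  ∑ w ∈ T, ENNReal.ofReal (q w) • Measure.dirac w

instance (T : Finset W) (q : W → ℝ) : IsFiniteMeasure (discreteLaw T q) := by
  refine ⟨?_⟩
  simp only [discreteLaw, Measure.finsetSum_apply, Measure.smul_apply, measure_univ, smul_eq_mul,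
    mul_one]
  exact ENNReal.sum_lt_top.2 fun _ _ => ENNReal.ofReal_lt_top

lemma discreteLaw_compl [MeasurableSingletonClass W] (T : Finset W) (q : W → ℝ) :
    discreteLaw T q (T : Set W)ᶜ = 0 := by
  simp only [discreteLaw, Measure.finsetSum_apply, Measure.smul_apply, smul_eq_mul]
  refine Finset.sum_eq_zero fun w hw => ?_
  rw [Measure.dirac_apply' _ T.measurableSet.compl]
  simp [hw]

lemma lintegral_discreteLaw [MeasurableSingletonClass W] (T : Finset W) (q : W → ℝ)
    (h : W → ℝ≥0∞) :
    ∫⁻ w, h w ∂(discreteLaw T q) = ∑ w ∈ T, ENNReal.ofReal (q w) * h w := by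
  simp [discreteLaw, lintegral_finsetSum_measure]

lemma integral_discreteLaw [MeasurableSingletonClass W] {T : Finset W} {q : W → ℝ}
    (hq : ∀ w ∈ T, 0 ≤ q w) (h : W → ℝ) :
    ∫ w, h w ∂(discreteLaw T q) = ∑ w ∈ T, q w * h w := by
  rw [discreteLaw, integral_finsetSum_measure fun w _ =>
    (integrable_dirac (by simp)).smul_measure ENNReal.ofReal_ne_top]
  refine Finset.sum_congr rfl fun w hw => ?_
  rw [integral_smul_measure, integral_dirac, ENNReal.toReal_ofReal (hq w hw), smul_eq_mul]

section DiscreteKernel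

variable [Finite Z] [MeasurableSingletonClass Z]

open Classical in
/-- The kernel whose law at `z` has density `g (z, ·)` with respect to `∑ w ∈ T, q w • δ_w`. At
points `z` of measure zero, where the density need not be normalized, it is `δ_{w₀}`. -/
noncomputable def discreteKernel (μ : Measure Z) (T : Finset W) (q : W → ℝ) (g : Z × W → ℝ)
    (w₀ : W) : Kernel Z W :=
  Kernel.ofFunOfCountable fun z => if μ {z} = 0 then Measure.dirac w₀ else
    (discreteLaw T q).withDensity fun w => ENNReal.ofReal (g (z, w))

variable {T : Finset W} {q : W → ℝ} {g : Z × W → ℝ} {w₀ : W}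

lemma isMarkovKernel_discreteKernel
    (hg₁ : ∀ z, μ {z} ≠ 0 → ∫⁻ w, ENNReal.ofReal (g (z, w)) ∂(discreteLaw T q) = 1) :
    IsMarkovKernel (discreteKernel μ T q g w₀) := by
  refine ⟨fun z => ?_⟩
  change IsProbabilityMeasure (ite _ _ _)
  split_ifs with h
  · infer_instance
  · exact ⟨by rw [withDensity_apply _ MeasurableSet.univ, setLIntegral_univ, hg₁ z h]⟩

lemma jointLawOne_discreteKernel (hg : Measurable g)
    (hg₁ : ∀ z, μ {z} ≠ 0 → ∫⁻ w, ENNReal.ofReal (g (z, w)) ∂(discreteLaw T q) = 1) :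
    jointLawOne μ (discreteKernel μ T q g w₀) =
      (μ.prod (discreteLaw T q)).withDensity fun p => ENNReal.ofReal (g p) := by
  have := isMarkovKernel_discreteKernel (w₀ := w₀) hg₁
  ext A hA
  rw [jointLawOne, Measure.compProd_apply hA, withDensity_apply _ hA, ← lintegral_indicator hA,
    lintegral_prod _ ((by fun_prop : Measurable fun p => ENNReal.ofReal (g p)).indicator
      hA).aemeasurable]
  refine lintegral_congr_ae ?_
  filter_upwards [ae_measure_singleton_ne_zero] with z hz
  have hAz : MeasurableSet (Prod.mk z ⁻¹' A) := measurable_prodMk_left hA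
  change (ite _ _ _ : Measure W) _ = _
  rw [if_neg hz, withDensity_apply _ hAz, ← lintegral_indicator hAz]
  rfl

variable [MeasurableSingletonClass W]

lemma snd_jointLawOne_discreteKernel (hg : Measurable g)
    (hg₁ : ∀ z, μ {z} ≠ 0 → ∫⁻ w, ENNReal.ofReal (g (z, w)) ∂(discreteLaw T q) = 1)
    (hg₂ : ∀ w ∈ T, ∫⁻ z, ENNReal.ofReal (g (z, w)) ∂μ = 1) :
    (jointLawOne μ (discreteKernel μ T q g w₀)).snd = discreteLaw T q := by
  rw [jointLawOne_discreteKernel hg hg₁, snd_prod_withDensity (by fun_prop)]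
  conv_rhs => rw [← withDensity_one (μ := discreteLaw T q)]
  refine withDensity_congr_ae ?_
  have hT : ∀ᵐ w ∂(discreteLaw T q), w ∈ T := discreteLaw_compl T q
  filter_upwards [hT] with w hw using hg₂ w hw

variable [IsProbabilityMeasure μ]

lemma mutualInfo_discreteKernel {f : ℝ → ℝ} (hf : ClassF f) (hg : Measurable g)
    (hg₁ : ∀ z, μ {z} ≠ 0 → ∫⁻ w, ENNReal.ofReal (g (z, w)) ∂(discreteLaw T q) = 1)
    (hg₂ : ∀ w ∈ T, ∫⁻ z, ENNReal.ofReal (g (z, w)) ∂μ = 1) :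
    mutualInfo .CKZ f (jointLawOne μ (discreteKernel μ T q g w₀)) =
      ∑ w ∈ T, ENNReal.ofReal (q w) *
        ∫⁻ z, ennFun (normalized f) (ENNReal.ofReal (g (z, w))) ∂μ := by
  have := isMarkovKernel_discreteKernel (w₀ := w₀) hg₁
  have hsnd := snd_jointLawOne_discreteKernel (w₀ := w₀) hg hg₁ hg₂
  have hfst : (jointLawOne μ (discreteKernel μ T q g w₀)).fst = μ := Measure.fst_compProd _ _
  have hP := jointLawOne_discreteKernel (w₀ := w₀) hg hg₁
  have : IsProbabilityMeasure (discreteLaw T q) := by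
    rw [← hsnd]; infer_instance
  have : IsProbabilityMeasure
      ((μ.prod (discreteLaw T q)).withDensity fun p => ENNReal.ofReal (g p)) := by
    rw [← hP]; infer_instance
  have hm : Measurable fun p => ENNReal.ofReal (g p) := by fun_prop
  rw [mutualInfo, hfst, hsnd, hP, fDiv_withDensity hf hm,
    lintegral_prod_symm' _ (hf.normalized.measurable_ennFun_comp hm), lintegral_discreteLaw]

lemma isAlgorithmOne_discreteKernel {ℓ : W → Z → ℝ}
    (hℓ : Measurable fun p : W × Z => ℓ p.1 p.2) (hq : ∀ w ∈ T, 0 ≤ q w) (hg : Measurable g)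
    (hg0 : ∀ p, 0 ≤ g p)
    (hg₁ : ∀ z, μ {z} ≠ 0 → ∫⁻ w, ENNReal.ofReal (g (z, w)) ∂(discreteLaw T q) = 1)
    (hg₂ : ∀ w ∈ T, ∫⁻ z, ENNReal.ofReal (g (z, w)) ∂μ = 1) :
    IsAlgorithmOne ℓ μ (discreteKernel μ T q g w₀) ∧
      genErrorOne ℓ μ (discreteKernel μ T q g w₀) =
        ∑ w ∈ T, q w * ∫ z, g (z, w) * genGapOne ℓ μ w z ∂μ := by
  have := isMarkovKernel_discreteKernel (w₀ := w₀) hg₁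
  have hgm := measurable_genGapOne (μ := μ) hℓ
  have hsnd := snd_jointLawOne_discreteKernel (w₀ := w₀) hg hg₁ hg₂
  have hP := jointLawOne_discreteKernel (w₀ := w₀) hg hg₁
  have : IsProbabilityMeasure (discreteLaw T q) := by
    rw [← hsnd]; infer_instance
  -- the gap takes finitely many values on the support of the joint law
  have hint : Integrable (fun p : Z × W => genGapOne ℓ μ p.2 p.1)
      (jointLawOne μ (discreteKernel μ T q g w₀)) := by
    have hfin : ((univ : Set Z) ×ˢ (T : Set W)).Finite := finite_univ.prod T.finite_toSet
    obtain ⟨C, hC⟩ := (hfin.image fun p => ‖genGapOne ℓ μ p.2 p.1‖).bddAbove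
    refine Integrable.of_bound hgm.aestronglyMeasurable C ?_
    have hT : ∀ᵐ w ∂(jointLawOne μ (discreteKernel μ T q g w₀)).snd, w ∈ T := by
      rw [hsnd]; exact discreteLaw_compl T q
    filter_upwards [ae_of_ae_map measurable_snd.aemeasurable hT] with p hp
    exact hC ⟨p, ⟨mem_univ _, hp⟩, rfl⟩
  refine ⟨⟨isMarkovKernel_discreteKernel hg₁, hint⟩, ?_⟩
  have hm : Measurable fun p => ENNReal.ofReal (g p) := by fun_prop
  have htop : ∀ᵐ p ∂(μ.prod (discreteLaw T q)), ENNReal.ofReal (g p) < ∞ :=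
    Filter.Eventually.of_forall fun p => ENNReal.ofReal_lt_top
  rw [hP, integrable_withDensity_iff_integrable_smul' hm htop] at hint
  rw [genErrorOne, hP, integral_withDensity_eq_integral_toReal_smul hm htop]
  simp only [ENNReal.toReal_ofReal (hg0 _), smul_eq_mul] at hint ⊢
  rw [integral_prod_symm _ hint, integral_discreteLaw hq]

/-- For a kernel on a finite sample space, the conditional law of the sample, its divergence and
the conditional mean of the gap given the output `w` are functions of `w`. A discretization of the
output law that keeps the first two means and does not decrease the third is the output law of a
kernel with at most `|Z| + 1` output values. -/
lemma exists_discreteKernel {f : ℝ → ℝ} (hf : ClassF f) {ℓ : W → Z → ℝ}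
    (hℓ : Measurable fun p : W × Z => ℓ p.1 p.2) {κ : Kernel Z W} (hκ : IsAlgorithmOne ℓ μ κ) :
    ∃ κ' : Kernel Z W, IsAlgorithmOne ℓ μ κ' ∧
      mutualInfo .CKZ f (jointLawOne μ κ') ≤ mutualInfo .CKZ f (jointLawOne μ κ) ∧
      (∃ T : Finset W, T.card ≤ Nat.card Z + 1 ∧ (jointLawOne μ κ').snd (T : Set W)ᶜ = 0) ∧
      genErrorOne ℓ μ κ ≤ genErrorOne ℓ μ κ' := by
  have := hκ.isMarkovKernel
  have := Fintype.ofFinite Z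
  set P := jointLawOne μ κ with hPdef
  set ν := P.snd with hν
  have hfst : P.fst = μ := Measure.fst_compProd _ _
  set G := P.rnDeriv (μ.prod ν)
  have hG : Measurable G := Measure.measurable_rnDeriv _ _
  have hP : P = (μ.prod ν).withDensity G :=
    (Measure.withDensity_rnDeriv_eq _ _ (jointLawOne_absolutelyContinuous κ)).symm
  have hPprob : IsProbabilityMeasure ((μ.prod ν).withDensity G) := by
    rw [← hP]; infer_instance
  have hGtop : ∀ᵐ p ∂(μ.prod ν), G p < ∞ := Measure.rnDeriv_lt_top _ _
  set g : Z × W → ℝ := fun p => (G p).toReal with hgdef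
  have hg : Measurable g := hG.ennreal_toReal
  -- the marginals of the density
  have hg₁ : ∀ z, μ {z} ≠ 0 → Integrable (fun w => g (z, w)) ν ∧ ∫ w, g (z, w) ∂ν = 1 := by
    intro z hz
    have h1 := of_ae_of_measure_singleton_ne_zero (ae_lintegral_eq_one_of_fst hG (hP ▸ hfst)) hz
    have hm : Measurable fun w => G (z, w) := hG.comp measurable_prodMk_left
    have h2 : ∫⁻ w, G (z, w) ∂ν ≠ ∞ := by simp [h1]
    exact ⟨integrable_toReal_of_lintegral_ne_top hm.aemeasurable h2, by
      simp only [hgdef]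
      rw [integral_toReal hm.aemeasurable (ae_lt_top hm h2), h1, ENNReal.toReal_one]⟩
  have hg₂ : ∀ᵐ w ∂ν, ∫ z, g (z, w) ∂μ = 1 := by
    filter_upwards [ae_lintegral_eq_one_of_snd hG (hP ▸ hν.symm)] with w h1
    have hm : Measurable fun z => G (z, w) := hG.comp measurable_prodMk_right
    simp only [hgdef]
    rw [integral_toReal hm.aemeasurable (ae_lt_top hm (by simp [h1])), h1, ENNReal.toReal_one]
  set H : W → ℝ≥0∞ := fun w => ∫⁻ z, ennFun (normalized f) (ENNReal.ofReal (g (z, w))) ∂μ with hH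
  have hHm : Measurable H := by
    have : Measurable fun p => ennFun (normalized f) (ENNReal.ofReal (g p)) :=
      hf.normalized.measurable_ennFun_comp (by fun_prop)
    exact this.lintegral_prod_left'
  have hHtop : ∀ w, H w ≠ ∞ := fun w => by
    simp only [hH, lintegral_fintype]
    exact ENNReal.sum_ne_top.2 fun z _ =>
      ENNReal.mul_ne_top ENNReal.ofReal_ne_top (measure_ne_top _ _)
  have hI : mutualInfo .CKZ f P = ∫⁻ w, H w ∂ν := by
    have he : ∀ p, ennFun (normalized f) (ENNReal.ofReal (g p)) = ennFun (normalized f) (G p) :=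
      fun p => by simp [ennFun, hgdef]
    have h1 : fDiv f P (μ.prod ν) = fDiv f ((μ.prod ν).withDensity G) (μ.prod ν) := by rw [← hP]
    rw [mutualInfo, hfst, ← hν, h1, fDiv_withDensity hf hG,
      lintegral_prod_symm' _ (hf.normalized.measurable_ennFun_comp hG)]
    simp only [hH, he]
  set c : W → ℝ := fun w => ∫ z, g (z, w) * genGapOne ℓ μ w z ∂μ with hc
  have hgap : Integrable (fun p => g p * genGapOne ℓ μ p.2 p.1) (μ.prod ν) := by
    have := hκ.integrable
    rw [← hPdef, hP, integrable_withDensity_iff_integrable_smul' hG hGtop] at this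
    exact this
  have hcint : Integrable c ν := hgap.integral_prod_right
  have hcgen : ∫ w, c w ∂ν = genErrorOne ℓ μ κ := by
    rw [genErrorOne, ← hPdef, hP, integral_withDensity_eq_integral_toReal_smul hG hGtop, hc,
      ← integral_prod_symm _ hgap]
    rfl
  -- if the information is infinite, its divergence component is replaced by zero
  obtain ⟨h, hhint, hhle⟩ : ∃ h : W → ℝ, Integrable h ν ∧ ∀ (T : Finset W) (q : W → ℝ),
      (∀ w ∈ T, 0 ≤ q w) → ∑ w ∈ T, q w * h w = ∫ w, h w ∂ν →
        ∑ w ∈ T, ENNReal.ofReal (q w) * H w ≤ ∫⁻ w, H w ∂ν := by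
    by_cases hfin : ∫⁻ w, H w ∂ν = ∞
    · exact ⟨0, integrable_zero _ _ _, fun T q _ _ => hfin ▸ le_top⟩
    refine ⟨fun w => (H w).toReal, integrable_toReal_of_lintegral_ne_top hHm.aemeasurable hfin,
      fun T q hq hsum => ?_⟩
    rw [integral_toReal hHm.aemeasurable (Filter.Eventually.of_forall fun w => (hHtop w).lt_top)]
      at hsum
    rw [← ENNReal.ofReal_toReal hfin, ← hsum, ENNReal.ofReal_sum_of_nonneg fun w hw =>
      mul_nonneg (hq w hw) ENNReal.toReal_nonneg]
    refine Finset.sum_le_sum fun w hw => ?_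
    rw [ENNReal.ofReal_mul (hq w hw), ENNReal.ofReal_toReal (hHtop w)]
  set Ψ : W → (Z → ℝ) × ℝ := fun w => (fun z => μ.real {z} * g (z, w), h w) with hΨ
  have hΨ₁ : Integrable (fun w => (fun z => μ.real {z} * g (z, w) : Z → ℝ)) ν := by
    refine Integrable.of_eval fun z => ?_
    by_cases hz : μ {z} = 0
    · simp [measureReal_def, hz]
    · exact (hg₁ z hz).1.const_mul _
  have hΨint : Integrable Ψ ν := hΨ₁.prodMk hhint
  set e : (Z → ℝ) × ℝ →ₗ[ℝ] ℝ :=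
    (∑ z, LinearMap.proj z : (Z → ℝ) →ₗ[ℝ] ℝ) ∘ₗ LinearMap.fst ℝ (Z → ℝ) ℝ with he
  have heΨ : ∀ w, e (Ψ w) = ∫ z, g (z, w) ∂μ := fun w => by
    rw [integral_fintype .of_finite]
    simp [he, hΨ]
  obtain ⟨T, q, hTS, hcard, hq, hsum, hcle⟩ := exists_discretization hΨint hcint
    (S := {w | ∫ z, g (z, w) ∂μ = 1}) hg₂ e fun w hw => (heΨ w).trans hw
  have hsum₁ : ∀ z, μ {z} ≠ 0 → ∑ w ∈ T, q w * g (z, w) = 1 := by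
    intro z hz
    have h1 := congrFun (congrArg Prod.fst hsum) z
    rw [fst_integral hΨint, eval_integral fun z => hΨ₁.eval z, integral_const_mul,
      (hg₁ z hz).2] at h1
    have hz' : μ.real {z} ≠ 0 := (measureReal_ne_zero_iff).2 hz
    refine mul_left_cancel₀ hz' ?_
    rw [← h1]
    simp [Prod.fst_sum, hΨ, Finset.mul_sum, mul_left_comm]
  have hsum₂ : ∑ w ∈ T, q w * h w = ∫ w, h w ∂ν := by
    have := congrArg Prod.snd hsum
    rw [snd_integral hΨint] at this
    simpa [Prod.snd_sum, hΨ] using this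
  have hw₁ : ∀ z, μ {z} ≠ 0 → ∫⁻ w, ENNReal.ofReal (g (z, w)) ∂(discreteLaw T q) = 1 := by
    intro z hz
    rw [lintegral_discreteLaw, ← ENNReal.ofReal_one, ← hsum₁ z hz,
      ENNReal.ofReal_sum_of_nonneg fun w hw => mul_nonneg (hq w hw) ENNReal.toReal_nonneg]
    exact Finset.sum_congr rfl fun w hw => (ENNReal.ofReal_mul (hq w hw)).symm
  have hw₂ : ∀ w ∈ T, ∫⁻ z, ENNReal.ofReal (g (z, w)) ∂μ = 1 := by
    intro w hw
    rw [← ofReal_integral_eq_lintegral_ofReal .of_finite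
      (Filter.Eventually.of_forall fun z => ENNReal.toReal_nonneg), hTS hw, ENNReal.ofReal_one]
  obtain ⟨w₀⟩ : Nonempty W := by
    have : Nonempty (Z × W) := nonempty_of_isProbabilityMeasure P
    exact this.map Prod.snd
  obtain ⟨ha, hgen⟩ := isAlgorithmOne_discreteKernel (w₀ := w₀) hℓ hq hg
    (fun p => ENNReal.toReal_nonneg) hw₁ hw₂
  refine ⟨discreteKernel μ T q g w₀, ha, ?_, ⟨T, ?_, ?_⟩, ?_⟩
  · rw [mutualInfo_discreteKernel hf hg hw₁ hw₂, hI]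
    exact hhle T q hq hsum₂
  · simpa [Module.finrank_prod, Nat.card_eq_fintype_card] using hcard
  · rw [snd_jointLawOne_discreteKernel hg hw₁ hw₂]
    exact discreteLaw_compl T q
  · rw [hgen, ← hcgen]
    exact hcle

end DiscreteKernel
end FiniteSupport
/-! ### Comparison of the suprema -/

section Suprema

variable {Z W : Type*} [MeasurableSpace Z] [MeasurableSpace W] {μ : Measure Z}
  {ℓ : W → Z → ℝ} {f : ℝ → ℝ}

lemma genError_le_U₁ {k : InfoKind} {n : ℕ} {κ : Kernel (Fin n → Z) W} (hκ : IsAlgorithm ℓ μ κ)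
    {R : ℝ≥0∞} (hR : mutualInfo k f (jointLaw μ κ) ≤ R) :
    (genError ℓ μ κ : EReal) ≤ U₁ k f ℓ μ n R :=
  le_iSup_of_le κ (le_iSup₂_of_le hκ hR le_rfl)

variable [IsProbabilityMeasure μ]

lemma U₁_le_U₂ (hℓ : Measurable fun p : W × Z => ℓ p.1 p.2) (hf : ClassF f) (k : InfoKind) {n : ℕ}
    (hn : 0 < n) (R : ℝ≥0∞) : U₁ k f ℓ μ n R ≤ U₂ k f ℓ μ (R / n) := by
  refine iSup_le fun κ => iSup₂_le fun hκ hR => ?_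
  have := hκ.isMarkovKernel
  obtain ⟨halg, hgen⟩ := isAlgorithmOne_averagedKernel hℓ hn hκ
  rw [← hgen]
  exact le_iSup_of_le (averagedKernel μ κ) (le_iSup₂_of_le halg
    ((mutualInfo_averagedKernel_le hf hn k).trans (ENNReal.div_le_div_right hR _)) le_rfl)

lemma U₂_eq_U₂Supp [Finite Z] [MeasurableSingletonClass Z] [MeasurableSingletonClass W]
    (hℓ : Measurable fun p : W × Z => ℓ p.1 p.2) (hf : ClassF f) (R : ℝ≥0∞) :
    U₂ .CKZ f ℓ μ R = U₂Supp .CKZ f ℓ μ R (Nat.card Z + 1) := by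
  refine le_antisymm ?_ ?_
  · refine iSup_le fun κ => iSup₂_le fun hκ hR => ?_
    obtain ⟨κ', halg, hI, hT, hgen⟩ := exists_discreteKernel hf hℓ hκ
    exact le_iSup_of_le κ' (le_iSup₂_of_le halg (hI.trans hR)
      (le_iSup_of_le hT (EReal.coe_le_coe_iff.2 hgen)))
  · exact iSup_le fun κ => iSup₂_le fun hκ hR => iSup_le fun _ =>
      le_iSup_of_le κ (le_iSup₂_of_le hκ hR le_rfl)

end Suprema

end GenBound

theorem mainTheorem3 {Z W : Type*} [MeasurableSpace Z] [MeasurableSpace W]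
    (μ : Measure Z) [IsProbabilityMeasure μ]
    (ℓ : W → Z → ℝ) (hℓ : Measurable fun p : W × Z => ℓ p.1 p.2)
    (hint : ∀ w, Integrable (ℓ w) μ)
    (f : ℝ → ℝ) (hf : GenBound.ClassF f) :
    (∀ (k : GenBound.InfoKind) (n : ℕ), 0 < n →
      (∀ R : ℝ≥0∞, GenBound.U₁ k f ℓ μ n R ≤ GenBound.U₂ k f ℓ μ (R / n)) ∧
      (∀ κ : Kernel (Fin n → Z) W, GenBound.IsAlgorithm ℓ μ κ →
        (GenBound.genError ℓ μ κ : EReal) ≤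
          GenBound.U₂ k f ℓ μ (GenBound.mutualInfo k f (GenBound.jointLaw μ κ) / n))) ∧
    (∀ [Finite Z] [MeasurableSingletonClass Z] [MeasurableSingletonClass W] (R : ℝ≥0∞),
      GenBound.U₂ .CKZ f ℓ μ R = GenBound.U₂Supp .CKZ f ℓ μ R (Nat.card Z + 1)) := by
  refine ⟨fun k n hn => ⟨GenBound.U₁_le_U₂ hℓ hf k hn, fun κ hκ => ?_⟩,
    fun R => GenBound.U₂_eq_U₂Supp hℓ hf R⟩
  exact (GenBound.genError_le_U₁ hκ le_rfl).trans
    (GenBound.U₁_le_U₂ hℓ hf k hn (GenBound.mutualInfo k f (GenBound.jointLaw μ κ)))
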